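/- Let $G_1,G_2$ be (Hausdorff) locally compact abelian groups with Haar measures $du$, $dv$, and let $1<p,q<\infty$. For measurable $f:G_1\times G_2\to\mathbb C$ and $A\times B\subset G_1\times G_2$ put $\|f\|_{L^{p,q}(A\times B)}=\big(\int_A(\int_B|f(u,v)|^q\,dv)^{p/q}du\big)^{1/p}$, and for $c:I\times I\to\mathbb C$ with $I$ a countable set put $\|c\|_{\ell^{p,q}}=\big(\sum_s(\sum_t|c(s,t)|^q)^{p/q}\big)^{1/p}$; for $\mathbf c=(c_1,\dots,c_r)$ put $\|\mathbf c\|_{\ell^{p,q}}=\sum_{i=1}^r\|c_i\|_{\ell^{p,q}}$. Let $(x_s)_{s\in I}\subset G_1$ and $(y_t)_{t\in I}\subset G_2$ be separated: there are neighbourhoods $U_1,U_2$ of the identities such that the sets $x_s+U_1$ are pairwise disjoint, and so are the sets $y_t+U_2$. Assume: * $\omega\in L^1(G_1\times G_2)$ is supported in $W=W_1\times W_2$, where $W_1\subset G_1$ and $W_2\subset G_2$ are compact and contain the identities; $\|\omega\|_1=\|\omega\|_{L^1(W)}$. * $K=K_1\times K_2$ with $K_1\subset G_1$, $K_2\subset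 G_2$ compact of Haar measures $\mu_1,\mu_2$, and $\widetilde K=K-W$. * $\Phi=(\phi_1,\dots,\phi_r)^T$ with $\phi_i\in L^{p,q}(G_1\times G_2)$ continuous and compactly supported, and there are $0<a_1\le a_2<\infty$ with $$a_1\|\mathbf c\|_{\ell^{p,q}}\le\Big\|\sum_{s,t}\mathbf c(s,t)^T\Phi(\cdot-x_s,\cdot-y_t)\Big\|_{L^{p,q}(\widetilde K)}\le a_2\|\mathbf c\|_{\ell^{p,q}}$$ for all $\mathbf c\in(\ell^{p,q})^r$ such that $\mathbf c(s,t)=0$ whenever $\Phi(\cdot-x_s,\cdot-y_t)\equiv0$ on $\widetilde K$. * With $\Omega=\bigcup_{i}\operatorname{supp}\phi_i$, the set $\widetilde K-\Omega$ is sequentially compact. * $\rho$ is a probability density on $K$ (with respect to $du\,dv$) with $0<C_{\rho,1}\le\rho\le C_{\rho,2}$ on $K$, and $(u_j,v_k)$, $(j,k)\in\mathbb N\times\mathbb N$, is a doubly indexed family of independent random points, each with density $\rho$ on $K$. Let $V_K(\Phi)$ be the set of all $f\in L^{p,q}(G_1\times G_2)$ with $f=\sum_{s,t}\mathbf c(s,t)^T\Phi(\cdot-x_s,\cdot-y_t)$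 a.e. on $\widetilde K$ for some $\mathbf c\in(\ell^{p,q})^r$, let $d$ be its (finite) real dimension as a space of functions on $\widetilde K$, and let $\widetilde C_\Phi=\sup_{(u,v)\in\widetilde K}\sum_{i=1}^r\sum_{s,t}|\phi_i(u-x_s,v-y_t)|$. With $f*\omega$ denoting convolution on $G_1\times G_2$, put, for $0<\mu\le1$, $$V_K(\Phi,\omega,\mu)=\{f\in V_K(\Phi):\ \mu\|\omega\|_1\|f\|_{L^{p,q}(\widetilde K)}\le\|f*\omega\|_{L^1(K)}\}.$$ Put $\mathcal A_1=2\exp\big(d\ln\tfrac{8\widetilde C_\Phi}{a_1}\big)$ and $\mathcal A_2=\tfrac{4}{3d(\ln2)^2}\big(\tfrac{4\widetilde C_\Phi}{a_1}\big)^{2d}$ (in the degenerate case $d=0$, read $\mathcal A_1=2$, $\mathcal A_2=0$, and read a quotient with denominator $0$ as $0$). Theorem. Let $0<\mu\le1$, $0<\eta<\mu C_{\rho,1}$, and let $n,m\in\mathbb N$ satisfy $$nm>\frac{108\sqrt2\,(\ln2)\,d}{\eta}\Big(2+\frac{162}{\eta}\Big).$$ Then there is an event of probability at least $$1-\mathcal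 A_1\exp\Big(-nm\,\frac{3a_1^2\eta^2}{4\widetilde C_\Phi(6\widetilde C_\Phi+\eta a_1)}\Big)-\mathcal A_2\exp\Big(-nm\,\frac{\eta^2}{72\sqrt2\,(81+\eta)}\Big)$$ on which, simultaneously for all $f\in V_K(\Phi,\omega,\mu)$, $$nm\|\omega\|_1(\mu C_{\rho,1}-\eta)\|f\|_{L^{p,q}(\widetilde K)}\le\sum_{j=1}^n\sum_{k=1}^m|(f*\omega)(u_j,v_k)|\le nm\|\omega\|_1\Big(C_{\rho,2}\,\mu_1^{\frac{p-1}p}\mu_2^{\frac{q-1}q}+\eta\Big)\|f\|_{L^{p,q}(\widetilde K)}.$$ -/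

import Mathlib

open MeasureTheory ProbabilityTheory
open scoped ENNReal Pointwise Topology

noncomputable section

namespace AvgSampling

/-- A family `x` in an additive topological group is `U`-separated for some neighbourhood `U`
of the identity: the translates `x i + U` are pairwise disjoint. -/
def IsSeparated {G I : Type*} [AddCommGroup G] [TopologicalSpace G] (x : I → G) : Prop :=
  ∃ U ∈ 𝓝 (0 : G), ∀ i j, i ≠ j → Disjoint ((fun g => x i + g) '' U) ((fun g => x j + g) '' U)

section Measure

variable {G₁ G₂ : Type*} [MeasurableSpace G₁] [MeasurableSpace G₂]

/-- The product of the Haar measures on a rectangle `A × B`. It is only used for compact `A`, `B`,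
so that both factors are finite measures even when the groups are not `σ`-compact. -/
def rect (ν₁ : Measure G₁) (ν₂ : Measure G₂) (A : Set G₁) (B : Set G₂) : Measure (G₁ × G₂) :=
  (ν₁.restrict A).prod (ν₂.restrict B)

/-- The mixed norm `‖f‖_{L^{p,q}(A × B)} = (∫_A (∫_B |f(u,v)|^q dv)^{p/q} du)^{1/p}`,
with values in `[0,∞]`. -/
def mixedNorm (ν₁ : Measure G₁) (ν₂ : Measure G₂) (p q : ℝ) (A : Set G₁) (B : Set G₂)
    (f : G₁ × G₂ → ℂ) : ℝ≥0∞ :=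
  (∫⁻ u in A, (∫⁻ v in B, ‖f (u, v)‖ₑ ^ q ∂ν₂) ^ (p / q) ∂ν₁) ^ (1 / p)

/-- The norm `‖f‖_{L¹(A × B)}` over a compact rectangle `A × B`. -/
def oneNorm (ν₁ : Measure G₁) (ν₂ : Measure G₂) (A : Set G₁) (B : Set G₂)
    (f : G₁ × G₂ → ℂ) : ℝ≥0∞ :=
  ∫⁻ x, ‖f x‖ₑ ∂(rect ν₁ ν₂ A B)

/-- `f ∈ L^{p,q}(G₁ × G₂)`. -/
def MemMixed (ν₁ : Measure G₁) (ν₂ : Measure G₂) (p q : ℝ) (f : G₁ × G₂ → ℂ) : Prop :=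
  Measurable f ∧ mixedNorm ν₁ ν₂ p q Set.univ Set.univ f < ∞

end Measure

/-- The mixed sequence norm `‖c‖_{ℓ^{p,q}} = (∑_s (∑_t |c(s,t)|^q)^{p/q})^{1/p}` in `[0,∞]`. -/
def seqNorm {I : Type*} (p q : ℝ) (c : I → I → ℂ) : ℝ≥0∞ :=
  (∑' s, (∑' t, ‖c s t‖ₑ ^ q) ^ (p / q)) ^ (1 / p)

section Group

variable {G₁ G₂ : Type*} [AddCommGroup G₁] [AddCommGroup G₂]

/-- The series `∑_{s,t} c(s,t)ᵀ Φ(· - x_s, · - y_t)`, evaluated pointwise (if the `φ i` have compact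
support and the nodes are separated, at each point only finitely many terms are nonzero). -/
def synth {I : Type*} {r : ℕ} (x : I → G₁) (y : I → G₂) (φ : Fin r → G₁ × G₂ → ℂ)
    (c : Fin r → I → I → ℂ) (z : G₁ × G₂) : ℂ :=
  ∑' st : I × I, ∑ i, c i st.1 st.2 * φ i (z.1 - x st.1, z.2 - y st.2)

/-- `C̃_Φ = sup_{(u,v) ∈ A × B} ∑_i ∑_{s,t} |φ_i(u - x_s, v - y_t)|`, where `A × B` will be `K̃`. -/
def CPhi {I : Type*} {r : ℕ} (x : I → G₁) (y : I → G₂) (φ : Fin r → G₁ × G₂ → ℂ)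
    (A : Set G₁) (B : Set G₂) : ℝ :=
  sSup ((fun z : G₁ × G₂ => ∑ i, ∑' st : I × I, ‖φ i (z.1 - x st.1, z.2 - y st.2)‖) '' (A ×ˢ B))

variable [MeasurableSpace G₁] [MeasurableSpace G₂]

/-- The convolution `(f * ω)(u,v) = ∫_{G₁} ∫_{G₂} f(u - u', v - v') ω(u',v') dv' du'`. -/
def conv (ν₁ : Measure G₁) (ν₂ : Measure G₂) (f ω : G₁ × G₂ → ℂ) (z : G₁ × G₂) : ℂ :=
  ∫ u, ∫ v, f (z.1 - u, z.2 - v) * ω (u, v) ∂ν₂ ∂ν₁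

/-- Stable shifts with constants `a₁ ≤ a₂` on the rectangle `A × B` (which will be `K̃`):
`a₁ ‖c‖ ≤ ‖∑ c(s,t)ᵀ Φ(· - x_s, · - y_t)‖_{L^{p,q}(A × B)} ≤ a₂ ‖c‖` for all `c ∈ (ℓ^{p,q})^r` such
that `c(s,t) = 0` whenever `Φ(· - x_s, · - y_t) ≡ 0` on `A × B`; here `‖c‖ = ∑_i ‖c_i‖`. -/
def StableShifts {I : Type*} {r : ℕ} (ν₁ : Measure G₁) (ν₂ : Measure G₂) (p q : ℝ)
    (x : I → G₁) (y : I → G₂) (φ : Fin r → G₁ × G₂ → ℂ) (A : Set G₁) (B : Set G₂)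
    (a₁ a₂ : ℝ) : Prop :=
  ∀ c : Fin r → I → I → ℂ, (∀ i, seqNorm p q (c i) < ∞) →
    (∀ s t, (∀ z ∈ A ×ˢ B, ∀ i, φ i (z.1 - x s, z.2 - y t) = 0) → ∀ i, c i s t = 0) →
    ENNReal.ofReal a₁ * ∑ i, seqNorm p q (c i) ≤ mixedNorm ν₁ ν₂ p q A B (synth x y φ c) ∧
    mixedNorm ν₁ ν₂ p q A B (synth x y φ c) ≤ ENNReal.ofReal a₂ * ∑ i, seqNorm p q (c i)

/-- The local quasi shift-invariant space `V_K(Φ)`, with `A × B` in the role of `K̃`: all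
`f ∈ L^{p,q}(G₁ × G₂)` that agree (almost everywhere) on `A × B` with
`∑ c(s,t)ᵀ Φ(· - x_s, · - y_t)` for some `c ∈ (ℓ^{p,q})^r`. -/
def VK {I : Type*} {r : ℕ} (ν₁ : Measure G₁) (ν₂ : Measure G₂) (p q : ℝ)
    (x : I → G₁) (y : I → G₂) (φ : Fin r → G₁ × G₂ → ℂ) (A : Set G₁) (B : Set G₂) :
    Set (G₁ × G₂ → ℂ) :=
  {f | MemMixed ν₁ ν₂ p q f ∧ ∃ c : Fin r → I → I → ℂ, (∀ i, seqNorm p q (c i) < ∞) ∧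
    f =ᵐ[rect ν₁ ν₂ A B] synth x y φ c}

/-- The dimension over `ℝ` of `V_K(Φ)` as a space of (classes of) functions on `K̃ = A × B`. The
restrictions to `A × B` already form a linear space, so the span adds nothing. -/
def dimVK {I : Type*} {r : ℕ} (ν₁ : Measure G₁) (ν₂ : Measure G₂) (p q : ℝ)
    (x : I → G₁) (y : I → G₂) (φ : Fin r → G₁ × G₂ → ℂ) (A : Set G₁) (B : Set G₂) : ℕ :=
  Module.finrank ℝ (Submodule.span ℝ
    {g : (G₁ × G₂) →ₘ[rect ν₁ ν₂ A B] ℂ |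
      ∃ f ∈ VK ν₁ ν₂ p q x y φ A B, (g : G₁ × G₂ → ℂ) =ᵐ[rect ν₁ ν₂ A B] f})

/-- `V_K(Φ,ω,μ)`: the `f ∈ V_K(Φ)` with
`μ ‖ω‖_{L¹(W)} ‖f‖_{L^{p,q}(K̃)} ≤ ‖f * ω‖_{L¹(K)}`, where `K̃ = (K₁ - W₁) × (K₂ - W₂)`. -/
def VKω {I : Type*} {r : ℕ} (ν₁ : Measure G₁) (ν₂ : Measure G₂) (p q : ℝ)
    (x : I → G₁) (y : I → G₂) (φ : Fin r → G₁ × G₂ → ℂ) (K₁ W₁ : Set G₁) (K₂ W₂ : Set G₂)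
    (ω : G₁ × G₂ → ℂ) (μ : ℝ) : Set (G₁ × G₂ → ℂ) :=
  {f | f ∈ VK ν₁ ν₂ p q x y φ (K₁ - W₁) (K₂ - W₂) ∧
    ENNReal.ofReal μ * oneNorm ν₁ ν₂ W₁ W₂ ω * mixedNorm ν₁ ν₂ p q (K₁ - W₁) (K₂ - W₂) f
      ≤ oneNorm ν₁ ν₂ K₁ K₂ (conv ν₁ ν₂ f ω)}

end Group

/-- `𝒜₁ = 2 exp(d ln(8 C / a₁))`. -/
def constA₁ (d : ℕ) (C a₁ : ℝ) : ℝ := 2 * Real.exp (d * Real.log (8 * C / a₁))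

/-- `𝒜₂ = 4 / (3 d (ln 2)²) · (4 C / a₁)^{2d}`. -/
def constA₂ (d : ℕ) (C a₁ : ℝ) : ℝ :=
  4 / (3 * d * Real.log 2 ^ 2) * (4 * C / a₁) ^ (2 * d)

end AvgSampling

end

set_option linter.unusedSectionVars false

/-! On `K̃` only finitely many shifts of `Φ` are not identically zero, because the nodes are
separated and all supports are compact (`finite_activeShifts`). So modulo null sets `V_K(Φ)` is the
image of a finite-dimensional coefficient space `E` under `c ↦ F c`. The lower stability bound gives
`a₁ ‖c‖ ≤ ‖F c‖` with the sup norm on `E`. Hence the map is injective and `E` has real dimension `d`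
(`finrank_eq_dimVK`). Conversely `|F c| ≤ C̃_Φ ‖c‖` on `K̃` (`norm_shiftSum_le`).

For `z ∈ K` the value `(f * ω)(z)` depends only on `f` on `K̃` (`conv_eq_average`), so it equals a
linear functional `V c z` of the coefficients with `|V c z| ≤ C̃_Φ ‖ω‖₁ ‖c‖`. Divided by `a₁ ‖ω‖₁`,
the variables `|V c (Z j k)|` are Lipschitz in `c` with constant `L = C̃_Φ / a₁`. It suffices that,
uniformly over the unit ball of `E`, the centred sum of these `N = nm` variables is at most `N η` in
absolute value. By homogeneity and stability the deviation is then at most `N η ‖ω‖₁ ‖f‖`. The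
expectations lie between `C_{ρ,1}` and `C_{ρ,2}` times `‖f * ω‖₁`; this norm is bounded below by the
definition of `V_K(Φ,ω,μ)` and above by Young's and Hölder's inequalities (`oneNorm_average_le`).

The uniform bound (`exists_event_abs_centeredSum_le`) is a chaining argument with Hoeffding's
inequality. Nets of radius `δ k`, halved at each level, have at most `(1 + 2 / δ k) ^ d` points. The
coarsest net is allowed the deviation `N η / 2`, and the link from level `k` to `k + 1` is allowed
`N η (3/4)^k / 8`; these allowances sum to `N η`. Link sizes decay like `2^{-k}`, so the Hoeffding
exponents grow like `(9/4)^k`, whereas the logarithm of the number of links grows only linearly in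
`k`. The coarse level produces the `𝒜₁` term and all the links together the `𝒜₂` term. -/

namespace AvgSampling

/-! ### Nets in the unit ball of a finite-dimensional space. -/

section Covering

variable {E : Type*} [NormedAddCommGroup E] [NormedSpace ℝ E] [FiniteDimensional ℝ E]

open Module Metric in
/-- Volume bound for the cardinality of a `δ`-separated subset of the unit ball. -/
theorem card_le_of_separated_unitBall {δ : ℝ} (hδ : 0 < δ) (s : Finset E)
    (hs : ∀ c ∈ s, ‖c‖ ≤ 1) (h : ∀ c ∈ s, ∀ e ∈ s, c ≠ e → δ ≤ ‖c - e‖) :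
    (s.card : ℝ) ≤ (1 + 2 / δ) ^ finrank ℝ E := by
  borelize E
  let μ : Measure E := Measure.addHaar
  have hδ2 : 0 < δ / 2 := by positivity
  have hρ : 0 < 1 + δ / 2 := by positivity
  -- The balls of radius `δ / 2` about separated points are disjoint and fit into the ball of radius
  -- `1 + δ / 2`; compare Haar volumes.
  set A := ⋃ c ∈ s, ball (c : E) (δ / 2) with hA
  have D : Set.Pairwise (s : Set E) (Function.onFun Disjoint fun c => ball (c : E) (δ / 2)) := by
    rintro c hc e he hce
    apply ball_disjoint_ball
    rw [dist_eq_norm]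
    linarith [h c hc e he hce]
  have A_subset : A ⊆ ball (0 : E) (1 + δ / 2) := by
    refine Set.iUnion₂_subset fun x hx => ?_
    apply ball_subset_ball'
    rw [dist_zero_right]
    linarith [hs x hx]
  have I : (s.card : ℝ≥0∞) * ENNReal.ofReal ((δ / 2) ^ finrank ℝ E) * μ (ball 0 1) ≤
      ENNReal.ofReal ((1 + δ / 2) ^ finrank ℝ E) * μ (ball 0 1) :=
    calc
      _ = μ A := by
        rw [hA, measure_biUnion_finset D fun c _ => measurableSet_ball]
        simp only [μ.addHaar_ball_of_pos _ hδ2]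
        simp only [Finset.sum_const, nsmul_eq_mul, mul_assoc]
      _ ≤ μ (ball (0 : E) (1 + δ / 2)) := measure_mono A_subset
      _ = _ := by simp only [μ.addHaar_ball_of_pos _ hρ]
  have J := (ENNReal.mul_le_mul_iff_left
    (measure_ball_pos μ _ zero_lt_one).ne' measure_ball_lt_top.ne).1 I
  have K := ENNReal.toReal_le_of_le_ofReal (pow_nonneg hρ.le _) J
  rw [ENNReal.toReal_mul, ENNReal.toReal_natCast, ENNReal.toReal_ofReal (by positivity)] at K
  have : 1 + 2 / δ = (1 + δ / 2) / (δ / 2) := by field_simp; ring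
  rw [this, div_pow, le_div_iff₀ (by positivity)]
  exact K

/-- The unit ball of a real normed space of dimension `d` has a `δ`-net of at most `(1 + 2/δ) ^ d`
points of the unit ball. -/
theorem exists_net_unitBall {δ : ℝ} (hδ : 0 < δ) :
    ∃ s : Finset E, (∀ c ∈ s, ‖c‖ ≤ 1) ∧ (∀ f : E, ‖f‖ ≤ 1 → ∃ c ∈ s, ‖f - c‖ ≤ δ) ∧
      (s.card : ℝ) ≤ (1 + 2 / δ) ^ Module.finrank ℝ E := by
  classical
  let T : Set ℕ := {k | ∃ s : Finset E, s.card = k ∧ (∀ c ∈ s, ‖c‖ ≤ 1) ∧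
    ∀ c ∈ s, ∀ e ∈ s, c ≠ e → δ ≤ ‖c - e‖}
  have hT : T.Nonempty := ⟨0, ∅, by simp⟩
  have hTb : BddAbove T := by
    obtain ⟨M, hM⟩ := exists_nat_ge ((1 + 2 / δ) ^ Module.finrank ℝ E)
    refine ⟨M, ?_⟩
    rintro _ ⟨s, rfl, h1, h2⟩
    exact_mod_cast (card_le_of_separated_unitBall hδ s h1 h2).trans hM
  -- A separated set of largest cardinality is a net, since an uncovered point could be added to it.
  obtain ⟨s, hs, h1, h2⟩ := Nat.sSup_mem hT hTb
  refine ⟨s, h1, fun f hf => ?_, card_le_of_separated_unitBall hδ s h1 h2⟩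
  by_contra! hcon
  have hfs : f ∉ s := fun hfs => by
    have := hcon f hfs
    simp at this
    linarith
  have : (insert f s).card ∈ T := by
    refine ⟨insert f s, rfl, ?_, ?_⟩
    · simp only [Finset.mem_insert]
      rintro c (rfl | hc)
      exacts [hf, h1 c hc]
    · simp only [Finset.mem_insert]
      rintro c (rfl | hc) e (rfl | he) hce
      · exact absurd rfl hce
      · exact (hcon e he).le
      · rw [norm_sub_rev]; exact (hcon c hc).le
      · exact h2 c hc e he hce
  have := le_csSup hTb this
  rw [Finset.card_insert_of_notMem hfs, hs] at this
  omega

end Covering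

/-! ### Hoeffding's inequality. -/

section Hoeffding

variable {S ι : Type*} [MeasurableSpace S] {P : Measure S} [IsProbabilityMeasure P]

/-- Two-sided Hoeffding inequality for independent variables with values in `[a, b]`. -/
theorem measure_abs_sum_sub_integral_ge_le {D : ι → S → ℝ} {J : Finset ι} {a b t : ℝ}
    (hm : ∀ j, Measurable (D j)) (hb : ∀ j s, D j s ∈ Set.Icc a b) (hind : iIndepFun D P)
    (ht : 0 ≤ t) :
    P.real {s | t ≤ |∑ j ∈ J, (D j s - ∫ s', D j s' ∂P)|} ≤
      2 * Real.exp (-(2 * t ^ 2 / (J.card * (b - a) ^ 2))) := by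
  -- Only the length of the interval matters, so the one-sided bound also serves `-D`, with values
  -- in `[-b, -a]`.
  have key : ∀ D : ι → S → ℝ, ∀ a' b' : ℝ, (b' - a') ^ 2 = (b - a) ^ 2 → (∀ j, Measurable (D j)) →
      (∀ j s, D j s ∈ Set.Icc a' b') → iIndepFun D P →
      P.real {s | t ≤ ∑ j ∈ J, (D j s - ∫ s', D j s' ∂P)} ≤
        Real.exp (-(2 * t ^ 2 / (J.card * (b - a) ^ 2))) := by
    intro D a' b' hab hm hb hind
    have h1 := HasSubgaussianMGF.measure_sum_ge_le_of_iIndepFun (μ := P)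
      (X := fun j s => D j s - ∫ s', D j s' ∂P) (s := J)
      (c := fun _ => (‖b' - a'‖₊ / 2) ^ 2)
      (hind.comp (fun j y => y - ∫ s', D j s' ∂P) (fun j => measurable_id.sub_const _))
      (fun j _ => hasSubgaussianMGF_of_mem_Icc (hm j).aemeasurable
        (Filter.Eventually.of_forall (hb j))) ht
    refine h1.trans (le_of_eq ?_)
    congr 1
    simp only [Finset.sum_const, nsmul_eq_mul]
    push_cast
    rw [div_pow, Real.norm_eq_abs, sq_abs, hab, neg_div]
    congr 1
    rw [show 2 * (↑J.card * ((b - a) ^ 2 / 2 ^ 2)) = (↑J.card * (b - a) ^ 2) / 2 by ring,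
      div_div_eq_mul_div]
    ring
  have h1 := key D a b rfl hm hb hind
  have h2 := key (fun j s => -D j s) (-b) (-a) (by ring) (fun j => (hm j).neg)
    (fun j s => ⟨neg_le_neg (hb j s).2, neg_le_neg (hb j s).1⟩)
    (hind.comp (fun _ y => -y) (fun _ => measurable_neg))
  have hsub : {s | t ≤ |∑ j ∈ J, (D j s - ∫ s', D j s' ∂P)|} ⊆
      {s | t ≤ ∑ j ∈ J, (D j s - ∫ s', D j s' ∂P)} ∪
      {s | t ≤ ∑ j ∈ J, (-D j s - ∫ s', -D j s' ∂P)} := by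
    intro s hs
    simp only [Set.mem_ofPred_eq, Set.mem_union] at hs ⊢
    rcases le_abs.1 hs with h | h
    · exact Or.inl h
    · right
      refine h.trans (le_of_eq ?_)
      rw [← Finset.sum_neg_distrib]
      refine Finset.sum_congr rfl fun j _ => ?_
      rw [integral_neg]; ring
  calc _ ≤ _ := measureReal_mono hsub (measure_ne_top _ _)
    _ ≤ _ := measureReal_union_le _ _
    _ ≤ _ := by linarith

end Hoeffding

/-! ### Numerical estimates for the levels of the chaining. -/

section Estimates

theorem one_le_four_thirds_div_log_two_sq : 1 ≤ 4 / (3 * Real.log 2 ^ 2) := by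
  have h1 : Real.log 2 < 1 := by linarith [Real.log_two_lt_d9]
  have h0 : 0 < Real.log 2 := Real.log_pos (by norm_num)
  rw [le_div_iff₀ (by positivity)]
  nlinarith

/-- The exponent in the second error term is larger than `3 d ln 2`. -/
theorem three_mul_log_two_lt {N d η : ℝ} (hη : 0 < η)
    (hN : 108 * √2 * Real.log 2 * d / η * (2 + 162 / η) < N) :
    3 * d * Real.log 2 < N * (η ^ 2 / (72 * √2 * (81 + η))) := by
  have h2 : 0 < √2 := by positivity
  -- The lower bound imposed on `N` is `3 d ln 2` divided by the exponent per sample, so the claim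
  -- is the hypothesis rearranged.
  have e : 108 * √2 * Real.log 2 * d / η * (2 + 162 / η) =
      3 * d * Real.log 2 * (72 * √2 * (81 + η) / η ^ 2) := by
    field_simp; ring
  rw [e] at hN
  have := mul_lt_mul_of_pos_right hN (show 0 < η ^ 2 / (72 * √2 * (81 + η)) by positivity)
  refine lt_of_eq_of_lt ?_ this
  field_simp

/-- Holds because `72 √2 · 81 > 7200`. This large gap between the stated exponent and the Hoeffding
scale `N η²` pays for the cardinalities of the nets. -/
theorem mul_le_mul_sq_of_exponent {N η : ℝ} (hN : 0 ≤ N) (hη : 0 < η) :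
    7200 * (N * (η ^ 2 / (72 * √2 * (81 + η)))) ≤ N * η ^ 2 := by
  have h2 : 1.4 ≤ √2 := Real.le_sqrt_of_sq_le (by norm_num)
  rw [mul_left_comm]
  refine mul_le_mul_of_nonneg_left ?_ hN
  rw [← mul_div_assoc, div_le_iff₀ (by positivity), mul_comm]
  refine mul_le_mul_of_nonneg_left ?_ (by positivity)
  nlinarith

/-- Moves the powers of `κ⁻¹` in the net sizes into the exponent, where the Hoeffding term absorbs
them. -/
theorem pow_le_exp_mul_sub_one {a : ℝ} (ha : 0 ≤ a) (d : ℕ) : a ^ d ≤ Real.exp (d * (a - 1)) := by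
  rw [Real.exp_nat_mul]
  exact pow_le_pow_left₀ ha (by linarith [Real.add_one_le_exp (a - 1)]) d

/-- The coarsest level of the chaining. -/
theorem coarse_level_bound {d : ℕ} {L κ N η : ℝ} (hL : 0 < L) (hη : 0 < η) (hN : 0 ≤ N)
    (hκ : κ = min 1 (4 * L)) (hQ : d ≤ N * η ^ 2) :
    (1 + 2 / (κ / (2 * L))) ^ d * (2 * Real.exp (-(N * η ^ 2 / (2 * L ^ 2)))) ≤
      2 * Real.exp (d * Real.log (8 * L)) *
        Real.exp (-(N * (3 * η ^ 2 / (4 * L * (6 * L + η))))) := by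
  have hκ0 : 0 < κ := by rw [hκ]; positivity
  have hκL : κ ≤ 4 * L := hκ ▸ min_le_right _ _
  have h1 : 1 + 2 / (κ / (2 * L)) ≤ 8 * L * κ⁻¹ := by
    have : 1 ≤ 4 * L / κ := (one_le_div hκ0).2 hκL
    have e : 2 / (κ / (2 * L)) = 4 * L / κ := by field_simp; ring
    have e2 : 8 * L * κ⁻¹ = 2 * (4 * L / κ) := by field_simp; ring
    rw [e, e2]; linarith
  have h2 : κ⁻¹ - 1 ≤ 1 / (16 * L ^ 2) := by
    rcases min_choice 1 (4 * L) with h | h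
    · rw [hκ, h]; simp; positivity
    · rw [hκ, h]
      have : 1 / (16 * L ^ 2) = (4 * L)⁻¹ ^ 2 := by field_simp; ring
      rw [this]
      nlinarith [sq_nonneg ((4 * L)⁻¹ - 1), inv_pos.2 (show 0 < 4 * L by positivity)]
  have h3 : N * (3 * η ^ 2 / (4 * L * (6 * L + η))) ≤ N * η ^ 2 / (8 * L ^ 2) := by
    rw [mul_div_assoc N]
    refine mul_le_mul_of_nonneg_left ?_ hN
    rw [div_le_div_iff₀ (by positivity) (by positivity)]
    nlinarith [mul_pos (pow_pos hη 3) hL]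
  have h4 : (d : ℝ) * (κ⁻¹ - 1) ≤ N * η ^ 2 / (16 * L ^ 2) := by
    calc (d : ℝ) * (κ⁻¹ - 1) ≤ d * (1 / (16 * L ^ 2)) := by gcongr
      _ ≤ (N * η ^ 2) * (1 / (16 * L ^ 2)) := by gcongr
      _ = _ := by ring
  have e8 : Real.exp (d * Real.log (8 * L)) = (8 * L) ^ d := by
    rw [Real.exp_nat_mul, Real.exp_log (by positivity)]
  rw [e8]
  calc _ ≤ (8 * L * κ⁻¹) ^ d * (2 * Real.exp (-(N * η ^ 2 / (2 * L ^ 2)))) := by gcongr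
    _ = 2 * (8 * L) ^ d * ((κ⁻¹) ^ d * Real.exp (-(N * η ^ 2 / (2 * L ^ 2)))) := by
        rw [mul_pow]; ring
    _ ≤ 2 * (8 * L) ^ d * (Real.exp (d * (κ⁻¹ - 1)) * Real.exp (-(N * η ^ 2 / (2 * L ^ 2)))) := by
        gcongr; exact pow_le_exp_mul_sub_one (by positivity) d
    _ ≤ _ := by
        rw [← Real.exp_add]
        refine mul_le_mul_of_nonneg_left (Real.exp_le_exp.2 ?_) (by positivity)
        -- A quarter of the Hoeffding exponent already dominates the stated one (`h3`); the rest
        -- covers the factor `κ⁻¹ ^ d` (`h4`).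
        have e : N * η ^ 2 / (2 * L ^ 2) = N * η ^ 2 / (8 * L ^ 2) + 6 * (N * η ^ 2 / (16 * L ^ 2)) := by
          field_simp; ring
        have : 0 ≤ N * η ^ 2 / (16 * L ^ 2) := by positivity
        rw [e]; linarith

/-- The `k`-th refinement level of the chaining. -/
theorem fine_level_bound {d : ℕ} {L κ τ Q : ℝ} (hd : 0 < d) (hL : 0 < L)
    (hκ0 : 0 < κ) (hκ1 : κ ≤ 1) (hκL : κ ≤ 4 * L) (hτ : 3 * d * Real.log 2 < τ)
    (hQ : 7200 * τ ≤ Q) (k : ℕ) :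
    ((1 + 2 / (κ / (2 ^ (k + 2) * L))) ^ d * (1 + 2 / (κ / (2 ^ (k + 1) * L))) ^ d) *
        (2 * Real.exp (-(Q * (9 / 4) ^ k / (72 * κ ^ 2)))) ≤
      4 / (3 * d * Real.log 2 ^ 2) * (4 * L) ^ (2 * d) * Real.exp (-τ) * (1 / 2 / 2 ^ k) := by
  have hl : 0 < Real.log 2 := Real.log_pos (by norm_num)
  have hl2 : 0.6 < Real.log 2 := by linarith [Real.log_two_gt_d9]
  have hd1 : (1 : ℝ) ≤ d := by exact_mod_cast hd
  have hτ0 : 0 < τ := lt_trans (by positivity) hτ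
  have hnet : ∀ j : ℕ, 1 + 2 / (κ / (2 ^ (j + 1) * L)) ≤ 4 * L * κ⁻¹ * 2 ^ (j + 1) := by
    intro j
    have h1 : 1 ≤ 4 * L * κ⁻¹ := by rw [← div_eq_mul_inv]; exact (one_le_div hκ0).2 hκL
    have h2 : (2 : ℝ) ≤ 2 ^ (j + 1) := by
      rw [pow_succ]; linarith [one_le_pow₀ (M₀ := ℝ) (a := 2) (by norm_num) (n := j)]
    have e : 2 / (κ / (2 ^ (j + 1) * L)) = 4 * L * κ⁻¹ * (2 ^ (j + 1) / 2) := by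
      field_simp; ring
    rw [e]
    nlinarith
  -- Bernoulli's inequality: the gain `(9/4)^k` outgrows the linear entropy `(2k + 3) d ln 2`.
  have hk : (k : ℝ) + 1 ≤ (9 / 4) ^ k := by
    have := one_add_mul_le_pow (a := (5 / 4 : ℝ)) (by norm_num) k
    norm_num at this
    have hk0 : (0 : ℝ) ≤ k := by positivity
    linarith
  set q := Q * (9 / 4) ^ k / 72 with hq
  have hq1 : 100 * (k + 1) * τ ≤ q := by
    rw [hq, le_div_iff₀ (by norm_num)]
    have : 7200 * τ * (k + 1) ≤ Q * (9 / 4) ^ k := by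
      apply mul_le_mul hQ hk (by positivity)
      linarith
    linarith
  have hk0 : (0 : ℝ) ≤ k := by positivity
  have hqd : (d : ℝ) ≤ q := by
    refine le_trans ?_ hq1
    nlinarith [mul_nonneg hk0 hτ0.le]
  set a := (κ⁻¹) ^ 2 with ha
  have ha1 : 1 ≤ a := one_le_pow₀ ((one_le_inv₀ hκ0).2 hκ1)
  have e1 : Q * (9 / 4) ^ k / (72 * κ ^ 2) = q * a := by
    rw [hq, ha]; field_simp
  have e2 : (4 * L * κ⁻¹ * 2 ^ (k + 2)) ^ d * (4 * L * κ⁻¹ * 2 ^ (k + 1)) ^ d =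
      (4 * L) ^ (2 * d) * a ^ d * Real.exp ((2 * k + 3) * d * Real.log 2) := by
    have : Real.exp ((2 * k + 3) * d * Real.log 2) = ((2 : ℝ) ^ (2 * k + 3)) ^ d := by
      rw [← pow_mul, ← Real.rpow_natCast, Real.rpow_def_of_pos (by norm_num)]
      push_cast; ring_nf
    rw [this, pow_mul, ha, ← mul_pow, ← mul_pow, ← mul_pow]
    congr 1
    ring
  rw [e1]
  calc _ ≤ ((4 * L * κ⁻¹ * 2 ^ (k + 2)) ^ d * (4 * L * κ⁻¹ * 2 ^ (k + 1)) ^ d) *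
        (2 * Real.exp (-(q * a))) := by
        gcongr
        · exact hnet (k + 1)
        · exact hnet k
    _ = (4 * L) ^ (2 * d) * 2 * (a ^ d * Real.exp ((2 * k + 3) * d * Real.log 2) *
          Real.exp (-(q * a))) := by rw [e2]; ring
    _ ≤ (4 * L) ^ (2 * d) * 2 * (Real.exp (d * (a - 1)) * Real.exp ((2 * k + 3) * d * Real.log 2) *
          Real.exp (-(q * a))) := by
        gcongr; exact pow_le_exp_mul_sub_one (by positivity) d
    -- The part `q (a - 1)` of the exponent pays for `d (a - 1)`, and the remaining `q ≥ 100 (k + 1)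
    -- τ` for everything else. The factor in `k` sums to one over the levels; the factor in `d`
    -- provides the `1 / d` in `𝒜₂`.
    _ ≤ (4 * L) ^ (2 * d) * 2 * (Real.exp (-τ) * Real.exp (-((d + 1) * Real.log 2)) *
          Real.exp (-((k + 1) * Real.log 2))) := by
        rw [← Real.exp_add, ← Real.exp_add, ← Real.exp_add, ← Real.exp_add]
        refine mul_le_mul_of_nonneg_left (Real.exp_le_exp.2 ?_) (by positivity)
        have h5 : (d : ℝ) * (a - 1) ≤ q * (a - 1) := by gcongr
        have h6 : (k + 1) * (3 * d * Real.log 2) ≤ (k + 1) * τ := by gcongr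
        have h7 : τ ≤ (k + 1) * τ := by nlinarith
        have h8 : Real.log 2 ≤ d * Real.log 2 := by nlinarith
        have h9 : k * Real.log 2 ≤ k * (d * Real.log 2) := by gcongr
        nlinarith
    _ = (4 * L) ^ (2 * d) * (1 / 2 ^ d) * Real.exp (-τ) * (1 / 2 / 2 ^ k) := by
        have e3 : ∀ j : ℕ, Real.exp (-((j + 1) * Real.log 2)) = 1 / 2 / 2 ^ j := by
          intro j
          rw [Real.exp_neg, mul_comm, ← Real.rpow_def_of_pos (by norm_num)]
          rw [Real.rpow_add_one (by norm_num), Real.rpow_natCast]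
          field_simp
        rw [e3, e3]; ring
    _ ≤ _ := by
        have hdp : (d : ℝ) ≤ 2 ^ d := by exact_mod_cast Nat.lt_two_pow_self.le
        have h10 : 1 / (2 : ℝ) ^ d ≤ 4 / (3 * d * Real.log 2 ^ 2) := by
          calc 1 / (2 : ℝ) ^ d ≤ 1 / d := by gcongr
            _ ≤ 1 / d * (4 / (3 * Real.log 2 ^ 2)) :=
              le_mul_of_one_le_right (by positivity) one_le_four_thirds_div_log_two_sq
            _ = _ := by field_simp
        rw [mul_comm ((4 * L) ^ (2 * d))]
        gcongr

end Estimates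

/-! ### Chaining for Lipschitz processes. -/

section Chaining

variable {S ι : Type*} [MeasurableSpace S] {P : Measure S}
  {E : Type*} [NormedAddCommGroup E]

/-- The sum over `J` of the centred variables `X f j`. -/
noncomputable def centeredSum (P : Measure S) (J : Finset ι) (X : E → ι → S → ℝ) (f : E) (s : S) : ℝ :=
  ∑ j ∈ J, (X f j s - ∫ s', X f j s' ∂P)

/-- A process that is `L`-Lipschitz in its parameter and vanishes at the parameter `0`. -/
structure LipschitzProcess (P : Measure S) (L : ℝ) (X : E → ι → S → ℝ) : Prop where
  measurable : ∀ f j, Measurable (X f j)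
  abs_sub_le : ∀ f g j s, |X f j s - X g j s| ≤ L * ‖f - g‖
  nonneg : ∀ f j s, 0 ≤ X f j s
  zero : ∀ j s, X 0 j s = 0
  -- Stated for differences because the links of the chain are differences; `g = 0` gives the
  -- variables themselves.
  indep : ∀ f g, iIndepFun (fun j s => X f j s - X g j s) P

namespace LipschitzProcess

variable {L : ℝ} {X : E → ι → S → ℝ}

theorem le (hX : LipschitzProcess P L X)
    (f : E) (j : ι) (s : S) : X f j s ≤ L * ‖f‖ := by
  have := hX.abs_sub_le f 0 j s
  rw [hX.zero, sub_zero, sub_zero] at this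
  exact (le_abs_self _).trans this

theorem integrable [IsProbabilityMeasure P] (hX : LipschitzProcess P L X)
    (f : E) (j : ι) : Integrable (X f j) P :=
  Integrable.of_bound (hX.measurable f j).aestronglyMeasurable (L * ‖f‖)
    (Filter.Eventually.of_forall fun s => by
      rw [Real.norm_eq_abs, abs_of_nonneg (hX.nonneg f j s)]; exact hX.le f j s)

theorem centeredSum_sub [IsProbabilityMeasure P] (hX : LipschitzProcess P L X)
    (J : Finset ι) (f g : E) (s : S) :
    centeredSum P J X f s - centeredSum P J X g s =
      ∑ j ∈ J, ((X f j s - X g j s) - ∫ s', (X f j s' - X g j s') ∂P) := by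
  rw [centeredSum, centeredSum, ← Finset.sum_sub_distrib]
  refine Finset.sum_congr rfl fun j _ => ?_
  rw [integral_sub (hX.integrable f j) (hX.integrable g j)]; ring

/-- A deterministic bound, valid at every sample point. It passes from the nets to arbitrary
parameters without a further exceptional set. -/
theorem abs_centeredSum_sub_le [IsProbabilityMeasure P] (hX : LipschitzProcess P L X)
    (J : Finset ι) (f g : E) (s : S) :
    |centeredSum P J X f s - centeredSum P J X g s| ≤ 2 * J.card * (L * ‖f - g‖) := by
  rw [hX.centeredSum_sub]
  refine (Finset.abs_sum_le_sum_abs _ _).trans ?_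
  calc _ ≤ ∑ _j ∈ J, 2 * (L * ‖f - g‖) := by
        refine Finset.sum_le_sum fun j _ => (abs_sub _ _).trans ?_
        have h2 : |∫ s', (X f j s' - X g j s') ∂P| ≤ L * ‖f - g‖ := by
          have := norm_integral_le_of_norm_le_const (μ := P) (C := L * ‖f - g‖)
            (f := fun s' => X f j s' - X g j s')
            (Filter.Eventually.of_forall fun s' => hX.abs_sub_le f g j s')
          simpa using this
        linarith [hX.abs_sub_le f g j s]
    _ = _ := by simp; ring

theorem measurable_centeredSum (hX : LipschitzProcess P L X)
    (J : Finset ι) (f : E) : Measurable (centeredSum P J X f) := by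
  unfold centeredSum
  exact Finset.measurable_fun_sum _ fun j _ => (hX.measurable f j).sub_const _

theorem measure_le_abs_centeredSum [IsProbabilityMeasure P] (hX : LipschitzProcess P L X)
    (J : Finset ι) {f : E} (hf : ‖f‖ ≤ 1) (hL : 0 ≤ L) {t : ℝ}
    (ht : 0 ≤ t) : P.real {s | t ≤ |centeredSum P J X f s|} ≤
      2 * Real.exp (-(2 * t ^ 2 / (J.card * L ^ 2))) := by
  have hind : iIndepFun (fun j => X f j) P := by
    have := hX.indep f 0
    simpa [hX.zero] using this
  have := measure_abs_sum_sub_integral_ge_le (J := J) (a := 0) (b := L) (hX.measurable f)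
    (fun j s => ⟨hX.nonneg f j s, (hX.le f j s).trans (mul_le_of_le_one_right hL hf)⟩) hind ht
  simpa [centeredSum] using this

theorem measure_le_abs_centeredSum_sub [IsProbabilityMeasure P] (hX : LipschitzProcess P L X)
    (J : Finset ι) {f g : E} {θ : ℝ} (hfg : ‖f - g‖ ≤ θ)
    (hL : 0 ≤ L) {t : ℝ} (ht : 0 ≤ t) :
    P.real {s | t ≤ |centeredSum P J X f s - centeredSum P J X g s|} ≤
      2 * Real.exp (-(2 * t ^ 2 / (J.card * (2 * (L * θ)) ^ 2))) := by
  have := measure_abs_sum_sub_integral_ge_le (J := J) (a := -(L * θ)) (b := L * θ)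
    (fun j => (hX.measurable f j).sub (hX.measurable g j))
    (fun j s => abs_le.1 ((hX.abs_sub_le f g j s).trans (by gcongr))) (hX.indep f g) ht
  simp_rw [hX.centeredSum_sub]
  rw [two_mul (L * θ)]
  simpa using this

/-- Uniform deviation bound over the unit ball of a finite dimensional space, by chaining. -/
theorem exists_event_abs_centeredSum_le [IsProbabilityMeasure P] [NormedSpace ℝ E] [FiniteDimensional ℝ E]
    (hX : LipschitzProcess P L X)
    (J : Finset ι) (d : ℕ) (hd : Module.finrank ℝ E = d) (hd0 : 0 < d) (hL : 0 < L)
    {η : ℝ} (hη : 0 < η)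
    (hN : 108 * √2 * Real.log 2 * d / η * (2 + 162 / η) < J.card) :
    ∃ A : Set S, MeasurableSet A ∧
      1 - 2 * Real.exp (d * Real.log (8 * L)) *
            Real.exp (-(J.card * (3 * η ^ 2 / (4 * L * (6 * L + η)))))
        - 4 / (3 * d * Real.log 2 ^ 2) * (4 * L) ^ (2 * d) *
            Real.exp (-(J.card * (η ^ 2 / (72 * √2 * (81 + η))))) ≤ P.real A ∧
      ∀ s ∈ A, ∀ f : E, ‖f‖ ≤ 1 → |centeredSum P J X f s| ≤ J.card * η := by
  classical
  set N : ℝ := (J.card : ℝ) with hNdef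
  have hl : 0 < Real.log 2 := Real.log_pos (by norm_num)
  have hN0 : 0 < N := lt_of_le_of_lt (by positivity) hN
  set τ := N * (η ^ 2 / (72 * √2 * (81 + η))) with hτdef
  have hτ : 3 * d * Real.log 2 < τ := three_mul_log_two_lt hη hN
  have hQ : 7200 * τ ≤ N * η ^ 2 := mul_le_mul_sq_of_exponent hN0.le hη
  have hQd : (d : ℝ) ≤ N * η ^ 2 := by
    have : 0.6 < Real.log 2 := by linarith [Real.log_two_gt_d9]
    have : (1 : ℝ) ≤ d := by exact_mod_cast hd0
    nlinarith
  -- The cap `4 * L` makes `1 ≤ 4 L / κ`, so the `1` in the net bound is absorbed into `8 L / κ`;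
  -- the cap `1` keeps the Hoeffding exponents from deteriorating for large `L`.
  set κ := min 1 (4 * L) with hκ
  have hκ0 : 0 < κ := by rw [hκ]; positivity
  have hκ1 : κ ≤ 1 := min_le_left _ _
  have hκL : κ ≤ 4 * L := min_le_right _ _
  let δ : ℕ → ℝ := fun k => κ / (2 ^ (k + 1) * L)
  have hδ : ∀ k, 0 < δ k := fun k => by positivity
  choose net hnet1 hnet2 hnet3 using fun k => exists_net_unitBall (E := E) (hδ k)
  rw [hd] at hnet3
  let Y := centeredSum P J X
  have hYm : ∀ f, Measurable (Y f) := hX.measurable_centeredSum J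
  let B₀ : Set S := ⋃ g ∈ net 0, {s | N * η / 2 ≤ |Y g s|}
  let pairs : ℕ → Finset (E × E) := fun k =>
    (net (k + 1) ×ˢ net k).filter fun p => ‖p.1 - p.2‖ ≤ δ (k + 1) + δ k
  let t : ℕ → ℝ := fun k => N * η * ((3 / 4) ^ k / 8)
  let B : ℕ → Set S := fun k => ⋃ p ∈ pairs k, {s | t k ≤ |Y p.1 s - Y p.2 s|}
  have hB₀m : MeasurableSet B₀ := Finset.measurableSet_biUnion _ fun g _ =>
    measurableSet_le measurable_const (hYm g).abs
  have hBm : ∀ k, MeasurableSet (B k) := fun k => Finset.measurableSet_biUnion _ fun p _ =>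
    measurableSet_le measurable_const ((hYm p.1).sub (hYm p.2)).abs
  set V₀ := 2 * Real.exp (d * Real.log (8 * L)) *
            Real.exp (-(N * (3 * η ^ 2 / (4 * L * (6 * L + η))))) with hV₀
  set V := 4 / (3 * d * Real.log 2 ^ 2) * (4 * L) ^ (2 * d) * Real.exp (-τ) with hV
  have hPB₀ : P.real B₀ ≤ V₀ := by
    calc P.real B₀ ≤ ∑ g ∈ net 0, P.real {s | N * η / 2 ≤ |Y g s|} :=
          measureReal_biUnion_finset_le _ _
      _ ≤ ∑ _g ∈ net 0, 2 * Real.exp (-(2 * (N * η / 2) ^ 2 / (N * L ^ 2))) :=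
          Finset.sum_le_sum fun g hg =>
            hX.measure_le_abs_centeredSum J (hnet1 0 g hg) hL.le (by positivity)
      _ = (net 0).card * (2 * Real.exp (-(N * η ^ 2 / (2 * L ^ 2)))) := by
          rw [Finset.sum_const, nsmul_eq_mul]
          congr 4
          field_simp
      _ ≤ (1 + 2 / (κ / (2 * L))) ^ d * (2 * Real.exp (-(N * η ^ 2 / (2 * L ^ 2)))) := by
          gcongr
          simpa [δ] using hnet3 0
      _ ≤ V₀ := coarse_level_bound hL hη hN0.le hκ hQd
  have hPB : ∀ k, P.real (B k) ≤ V * (1 / 2 / 2 ^ k) := by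
    intro k
    calc P.real (B k) ≤ ∑ p ∈ pairs k, P.real {s | t k ≤ |Y p.1 s - Y p.2 s|} :=
          measureReal_biUnion_finset_le _ _
      _ ≤ ∑ _p ∈ pairs k, 2 * Real.exp
            (-(2 * (t k) ^ 2 / (N * (2 * (L * (δ (k + 1) + δ k))) ^ 2))) :=
          Finset.sum_le_sum fun p hp => hX.measure_le_abs_centeredSum_sub J
            (Finset.mem_filter.1 hp).2 hL.le (by positivity)
      _ = (pairs k).card * (2 * Real.exp (-((N * η ^ 2) * (9 / 4) ^ k / (72 * κ ^ 2)))) := by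
          rw [Finset.sum_const, nsmul_eq_mul]
          congr 4
          have e1 : L * (δ (k + 1) + δ k) = 3 * κ / (4 * 2 ^ k) := by
            simp only [δ]; field_simp; ring
          have e2 : ((3 / 4 : ℝ) ^ k) ^ 2 * (2 ^ k) ^ 2 = (9 / 4) ^ k := by
            rw [← pow_mul, ← pow_mul, mul_comm k 2, pow_mul, pow_mul, ← mul_pow]; norm_num
          rw [e1, ← e2]
          simp only [t]
          field_simp; ring
      _ ≤ ((1 + 2 / (κ / (2 ^ (k + 2) * L))) ^ d * (1 + 2 / (κ / (2 ^ (k + 1) * L))) ^ d) *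
            (2 * Real.exp (-((N * η ^ 2) * (9 / 4) ^ k / (72 * κ ^ 2)))) := by
          gcongr
          have h1 : ((pairs k).card : ℝ) ≤ (net (k + 1)).card * (net k).card := by
            rw [← Nat.cast_mul, ← Finset.card_product]
            exact_mod_cast Finset.card_filter_le _ _
          exact h1.trans (mul_le_mul (hnet3 (k + 1)) (hnet3 k) (by positivity) (by positivity))
      _ ≤ _ := fine_level_bound hd0 hL hκ0 hκ1 hκL hτ hQ k
  have hV0 : 0 ≤ V := by positivity
  have hPU : P.real (⋃ k, B k) ≤ V := by
    have h1 : P (⋃ k, B k) ≤ ENNReal.ofReal V := by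
      calc P (⋃ k, B k) ≤ ∑' k, P (B k) := measure_iUnion_le _
        _ ≤ ∑' k, ENNReal.ofReal (V * (1 / 2 / 2 ^ k)) := by
            refine ENNReal.tsum_le_tsum fun k => ?_
            rw [← ofReal_measureReal (measure_ne_top _ _)]
            exact ENNReal.ofReal_le_ofReal (hPB k)
        _ = ENNReal.ofReal (∑' k, V * (1 / 2 / 2 ^ k)) :=
            (ENNReal.ofReal_tsum_of_nonneg (fun k => by positivity)
              ((summable_geometric_two' 1).mul_left V)).symm
        _ = ENNReal.ofReal V := by rw [tsum_mul_left, tsum_geometric_two', mul_one]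
    exact ENNReal.toReal_le_of_le_ofReal hV0 h1
  -- Only countably many bad events are removed, so no supremum over the ball has to be measurable.
  refine ⟨(B₀ ∪ ⋃ k, B k)ᶜ, (hB₀m.union (MeasurableSet.iUnion hBm)).compl, ?_, ?_⟩
  · rw [probReal_compl_eq_one_sub (hB₀m.union (MeasurableSet.iUnion hBm))]
    linarith [measureReal_union_le (μ := P) B₀ (⋃ k, B k)]
  · intro s hs f hf
    simp only [Set.mem_compl_iff, Set.mem_union, not_or, Set.mem_iUnion, not_exists] at hs
    obtain ⟨hs0, hs1⟩ := hs
    choose g hg1 hg2 using fun k => hnet2 k f hf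
    -- The right side is `N η / 2` plus the first `k` allowances `t`.
    have hstep : ∀ k, |Y (g k) s| ≤ N * η * (1 - (3 / 4) ^ k / 2) := by
      intro k
      induction k with
      | zero =>
        by_contra! hcon
        refine hs0 (Set.mem_biUnion (hg1 0) ?_)
        simp only [Set.mem_ofPred_eq]
        refine le_of_eq_of_le ?_ hcon.le
        ring
      | succ k ih =>
        have h1 : |Y (g (k + 1)) s - Y (g k) s| ≤ t k := by
          by_contra! hcon
          refine hs1 k (Set.mem_biUnion (x := (g (k + 1), g k)) ?_ hcon.le)
          refine Finset.mem_filter.2 ⟨Finset.mk_mem_product (hg1 _) (hg1 _), ?_⟩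
          calc ‖g (k + 1) - g k‖ = ‖(f - g k) - (f - g (k + 1))‖ := by congr 1; abel
            _ ≤ ‖f - g k‖ + ‖f - g (k + 1)‖ := norm_sub_le _ _
            _ ≤ _ := by linarith [hg2 k, hg2 (k + 1)]
        have h2 : |Y (g (k + 1)) s| ≤ |Y (g k) s| + |Y (g (k + 1)) s - Y (g k) s| := by
          linarith [abs_sub_abs_le_abs_sub (Y (g (k + 1)) s) (Y (g k) s)]
        have h3 : N * η * (1 - (3 / 4) ^ (k + 1) / 2) =
          N * η * (1 - (3 / 4) ^ k / 2) + t k := by simp only [t]; ring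
        linarith
    have hk : ∀ k, |Y f s| ≤ N * η + N * κ * (1 / 2) ^ k := by
      intro k
      have h1 := hX.abs_centeredSum_sub_le J f (g k) s
      have h2 : 2 * N * (L * ‖f - g k‖) ≤ N * κ * (1 / 2) ^ k := by
        calc 2 * N * (L * ‖f - g k‖) ≤ 2 * N * (L * δ k) := by gcongr; exact hg2 k
          _ = _ := by simp only [δ]; rw [one_div, inv_pow]; field_simp; ring
      have h3 := abs_sub_abs_le_abs_sub (Y f s) (Y (g k) s)
      have h4 : N * η * (1 - (3 / 4) ^ k / 2) ≤ N * η :=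
        mul_le_of_le_one_right (by positivity) (by linarith [pow_pos (show (0 : ℝ) < 3 / 4 by norm_num) k])
      have h5 := hstep k
      change |Y f s - Y (g k) s| ≤ _ at h1
      linarith
    have hlim : Filter.Tendsto (fun k : ℕ => N * η + N * κ * (1 / 2) ^ k) Filter.atTop
        (𝓝 (N * η + N * κ * 0)) :=
      ((tendsto_pow_atTop_nhds_zero_of_lt_one (by norm_num) (by norm_num)).const_mul _).const_add _
    have := ge_of_tendsto' hlim hk
    simpa using this

end LipschitzProcess

end Chaining

/-! ### Measurability of continuous functions for the product `σ`-algebra. -/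

section CompactMeasurability

variable {Z : Type*} [TopologicalSpace Z] [T2Space Z] [MeasurableSpace Z]

/-- If every point has arbitrarily small measurable neighbourhoods, a continuous function cut off
to a measurable compact set is measurable. This applies to products of Borel spaces with the
product `σ`-algebra, without countability assumptions. -/
theorem measurable_indicator_of_isCompact_real
    (hZ : ∀ z : Z, ∀ U ∈ 𝓝 z, ∃ M, MeasurableSet M ∧ M ∈ 𝓝 z ∧ M ⊆ U) {Q : Set Z}
    (hQ : IsCompact Q) (hQm : MeasurableSet Q) {g : Z → ℝ} (hg : Continuous g) :
    Measurable (Q.indicator g) := by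
  refine measurable_of_Ici fun a => ?_
  have hlevel : MeasurableSet (Q ∩ {z | a ≤ g z}) := by
    have hc : IsCompact (Q ∩ {z | a ≤ g z}) := hQ.inter_right (isClosed_le continuous_const hg)
    -- By compactness a finite union of measurable neighbourhoods fits between the level set and a
    -- slightly larger one; intersecting over `n` recovers the level set.
    have key : ∀ n : ℕ, ∃ M : Set Z, MeasurableSet M ∧ Q ∩ {z | a ≤ g z} ⊆ M ∧
        M ⊆ {z | a - 1 / ((n : ℝ) + 1) < g z} := by
      intro n
      have hn : 0 < 1 / ((n : ℝ) + 1) := by positivity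
      have : ∀ z : Z, ∃ M, MeasurableSet M ∧ (z ∈ Q ∩ {z | a ≤ g z} → M ∈ 𝓝 z) ∧
          M ⊆ {z | a - 1 / ((n : ℝ) + 1) < g z} := by
        intro z
        by_cases hz : z ∈ Q ∩ {z | a ≤ g z}
        · obtain ⟨M, h1, h2, h3⟩ := hZ z {z | a - 1 / ((n : ℝ) + 1) < g z}
            ((isOpen_lt continuous_const hg).mem_nhds (by
              have := hz.2; simp only [Set.mem_ofPred_eq] at this ⊢; linarith))
          exact ⟨M, h1, fun _ => h2, h3⟩
        · exact ⟨∅, MeasurableSet.empty, fun h => absurd h hz, Set.empty_subset _⟩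
      choose M h1 h2 h3 using this
      obtain ⟨t, -, ht⟩ := hc.elim_nhds_subcover M h2
      exact ⟨_, Finset.measurableSet_biUnion t fun z _ => h1 z, ht,
        Set.iUnion₂_subset fun z _ => h3 z⟩
    choose M h1 h2 h3 using key
    have : Q ∩ {z | a ≤ g z} = Q ∩ ⋂ n, M n := by
      refine Set.Subset.antisymm (fun z hz => ⟨hz.1, Set.mem_iInter.2 fun n => h2 n hz⟩) ?_
      rintro z ⟨hzQ, hz⟩
      refine ⟨hzQ, ?_⟩
      have hlim : Filter.Tendsto (fun n : ℕ => a - 1 / ((n : ℝ) + 1)) Filter.atTop (𝓝 (a - 0)) :=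
        tendsto_one_div_add_atTop_nhds_zero_nat.const_sub a
      rw [sub_zero] at hlim
      exact le_of_tendsto' hlim fun n => (h3 n (Set.mem_iInter.1 hz n)).le
    rw [this]
    exact hQm.inter (MeasurableSet.iInter h1)
  by_cases ha : a ≤ 0
  · have : Q.indicator g ⁻¹' Set.Ici a = (Q ∩ {z | a ≤ g z}) ∪ Qᶜ := by
      ext z; by_cases hz : z ∈ Q <;> simp [hz, ha]
    rw [this]; exact hlevel.union hQm.compl
  · have : Q.indicator g ⁻¹' Set.Ici a = Q ∩ {z | a ≤ g z} := by
      ext z; by_cases hz : z ∈ Q <;> simp [hz, ha]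
    rwa [this]

theorem measurable_indicator_of_isCompact
    (hZ : ∀ z : Z, ∀ U ∈ 𝓝 z, ∃ M, MeasurableSet M ∧ M ∈ 𝓝 z ∧ M ⊆ U) {Q : Set Z}
    (hQ : IsCompact Q) (hQm : MeasurableSet Q) {g : Z → ℂ} (hg : Continuous g) :
    Measurable (Q.indicator g) := by
  refine measurable_of_re_im (𝕜 := ℂ) ?_ ?_
  · convert measurable_indicator_of_isCompact_real hZ hQ hQm (Complex.continuous_re.comp hg)
      using 1
    ext z; by_cases hz : z ∈ Q <;> simp [hz]
  · convert measurable_indicator_of_isCompact_real hZ hQ hQm (Complex.continuous_im.comp hg)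
      using 1
    ext z; by_cases hz : z ∈ Q <;> simp [hz]

end CompactMeasurability

theorem exists_measurable_nhds_prod {X Y : Type*} [TopologicalSpace X] [MeasurableSpace X]
    [TopologicalSpace Y] [MeasurableSpace Y]
    (hX : ∀ z : X, ∀ U ∈ 𝓝 z, ∃ M, MeasurableSet M ∧ M ∈ 𝓝 z ∧ M ⊆ U)
    (hY : ∀ z : Y, ∀ U ∈ 𝓝 z, ∃ M, MeasurableSet M ∧ M ∈ 𝓝 z ∧ M ⊆ U) :
    ∀ z : X × Y, ∀ U ∈ 𝓝 z, ∃ M, MeasurableSet M ∧ M ∈ 𝓝 z ∧ M ⊆ U := by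
  rintro ⟨a, b⟩ U hU
  obtain ⟨A, hA, B, hB, hAB⟩ := mem_nhds_prod_iff.1 hU
  obtain ⟨M, h1, h2, h3⟩ := hX a A hA
  obtain ⟨M', h1', h2', h3'⟩ := hY b B hB
  exact ⟨M ×ˢ M', h1.prod h1', prod_mem_nhds h2 h2', (Set.prod_mono h3 h3').trans hAB⟩

theorem exists_measurable_nhds {Z : Type*} [TopologicalSpace Z] [MeasurableSpace Z]
    [OpensMeasurableSpace Z] :
    ∀ z : Z, ∀ U ∈ 𝓝 z, ∃ M, MeasurableSet M ∧ M ∈ 𝓝 z ∧ M ⊆ U := by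
  intro z U hU
  obtain ⟨V, hVU, hV, hz⟩ := mem_nhds_iff.1 hU
  exact ⟨V, hV.measurableSet, hV.mem_nhds hz, hVU⟩

/-! ### Mixed norms and Hölder's inequality. -/

section MixedNorm

variable {G₁ G₂ : Type*} [MeasurableSpace G₁] [MeasurableSpace G₂]
  {ν₁ : Measure G₁} {ν₂ : Measure G₂}

theorem ae_rect_mem {A : Set G₁} {B : Set G₂} (hA : MeasurableSet A) (hB : MeasurableSet B) :
    ∀ᵐ z ∂(rect ν₁ ν₂ A B), z ∈ A ×ˢ B := by
  filter_upwards [Measure.quasiMeasurePreserving_fst.ae (ae_restrict_mem hA),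
    Measure.quasiMeasurePreserving_snd.ae (ae_restrict_mem hB)] with z h1 h2
  exact ⟨h1, h2⟩

theorem mixedNorm_congr_ae {A : Set G₁} {B : Set G₂} [SFinite (ν₂.restrict B)] (p q : ℝ)
    {f g : G₁ × G₂ → ℂ} (h : f =ᵐ[rect ν₁ ν₂ A B] g) :
    mixedNorm ν₁ ν₂ p q A B f = mixedNorm ν₁ ν₂ p q A B g := by
  unfold mixedNorm
  congr 1
  refine lintegral_congr_ae ?_
  filter_upwards [Measure.ae_ae_of_ae_prod h] with u hu
  congr 1
  refine lintegral_congr_ae ?_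
  filter_upwards [hu] with v hv
  rw [hv]

theorem mixedNorm_mono_set {A A' : Set G₁} {B B' : Set G₂} {p q : ℝ} (hp : 0 < p) (hq : 0 < q)
    (hA : A ⊆ A') (hB : B ⊆ B') (f : G₁ × G₂ → ℂ) :
    mixedNorm ν₁ ν₂ p q A B f ≤ mixedNorm ν₁ ν₂ p q A' B' f := by
  unfold mixedNorm
  gcongr

/-- Hölder's inequality against the constant function. -/
theorem lintegral_le_rpow_mul {α : Type*} [MeasurableSpace α] (m : Measure α) {p : ℝ} (hp : 1 < p)
    {g : α → ℝ≥0∞} (hg : AEMeasurable g m) :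
    ∫⁻ a, g a ∂m ≤ (∫⁻ a, g a ^ p ∂m) ^ (1 / p) * m Set.univ ^ ((p - 1) / p) := by
  have hpq := Real.HolderConjugate.conjExponent hp
  have h := ENNReal.lintegral_mul_le_Lp_mul_Lq m hpq hg (g := fun _ => 1) aemeasurable_const
  simp only [Pi.mul_apply, mul_one, ENNReal.one_rpow, lintegral_const, one_mul] at h
  have e : 1 / p.conjExponent = (p - 1) / p := by rw [Real.conjExponent, one_div_div]
  rwa [e] at h

end MixedNorm

/-! ### The convolution as a cut-off average, and Young's inequality. -/

section Average

variable {G₁ G₂ : Type*}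
    [AddCommGroup G₁] [TopologicalSpace G₁] [IsTopologicalAddGroup G₁]
    [T2Space G₁] [MeasurableSpace G₁] [BorelSpace G₁]
    [AddCommGroup G₂] [TopologicalSpace G₂] [IsTopologicalAddGroup G₂]
    [T2Space G₂] [MeasurableSpace G₂] [BorelSpace G₂]

/-- The kernel `F (z - w)` cut off to `z ∈ K₁ × K₂` and `w ∈ W₁ × W₂`. -/
noncomputable def cutKernel (K₁ W₁ : Set G₁) (K₂ W₂ : Set G₂) (F : G₁ × G₂ → ℂ) :
    (G₁ × G₂) × (G₁ × G₂) → ℂ :=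
  ((K₁ ×ˢ K₂) ×ˢ (W₁ ×ˢ W₂)).indicator fun a => F (a.1 - a.2)

/-- The convolution of `F` and `ω`, cut off to `K₁ × K₂`. -/
noncomputable def average (ν₁ : Measure G₁) (ν₂ : Measure G₂) (K₁ W₁ : Set G₁) (K₂ W₂ : Set G₂)
    (ω F : G₁ × G₂ → ℂ) (z : G₁ × G₂) : ℂ :=
  ∫ w, cutKernel K₁ W₁ K₂ W₂ F (z, w) * ω w ∂(rect ν₁ ν₂ W₁ W₂)

variable {ν₁ : Measure G₁} {ν₂ : Measure G₂} {K₁ W₁ : Set G₁} {K₂ W₂ : Set G₂}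

/-- Without second countability the product `σ`-algebra can be smaller than the Borel one, so
continuity of `F (z - w)` alone is not enough; the compact cut-off is what makes it measurable. -/
theorem measurable_cutKernel (hK₁ : IsCompact K₁) (hK₂ : IsCompact K₂) (hW₁ : IsCompact W₁)
    (hW₂ : IsCompact W₂) {F : G₁ × G₂ → ℂ} (hF : Continuous F) :
    Measurable (cutKernel K₁ W₁ K₂ W₂ F) := by
  have h := exists_measurable_nhds_prod (exists_measurable_nhds (Z := G₁))
    (exists_measurable_nhds (Z := G₂))
  exact measurable_indicator_of_isCompact (exists_measurable_nhds_prod h h)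
    ((hK₁.prod hK₂).prod (hW₁.prod hW₂))
    ((hK₁.measurableSet.prod hK₂.measurableSet).prod (hW₁.measurableSet.prod hW₂.measurableSet))
    (by fun_prop)

theorem norm_cutKernel_le {F : G₁ × G₂ → ℂ} {B : ℝ} (hB0 : 0 ≤ B)
    (hB : ∀ z ∈ (K₁ - W₁) ×ˢ (K₂ - W₂), ‖F z‖ ≤ B) (a : (G₁ × G₂) × (G₁ × G₂)) :
    ‖cutKernel K₁ W₁ K₂ W₂ F a‖ ≤ B := by
  unfold cutKernel
  by_cases ha : a ∈ (K₁ ×ˢ K₂) ×ˢ (W₁ ×ˢ W₂)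
  · rw [Set.indicator_of_mem ha]
    exact hB _ ⟨Set.sub_mem_sub ha.1.1 ha.2.1, Set.sub_mem_sub ha.1.2 ha.2.2⟩
  · rw [Set.indicator_of_notMem ha]; simpa

section

variable {ω : G₁ × G₂ → ℂ}

theorem integrable_cutKernel_mul (hK₁ : IsCompact K₁) (hK₂ : IsCompact K₂) (hW₁ : IsCompact W₁)
    (hW₂ : IsCompact W₂) (hω : Integrable ω (rect ν₁ ν₂ W₁ W₂)) {F : G₁ × G₂ → ℂ}
    (hF : Continuous F) {B : ℝ} (hB0 : 0 ≤ B)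
    (hB : ∀ z ∈ (K₁ - W₁) ×ˢ (K₂ - W₂), ‖F z‖ ≤ B) (z : G₁ × G₂) :
    Integrable (fun w => cutKernel K₁ W₁ K₂ W₂ F (z, w) * ω w) (rect ν₁ ν₂ W₁ W₂) :=
  hω.bdd_mul ((measurable_cutKernel hK₁ hK₂ hW₁ hW₂ hF).comp
    measurable_prodMk_left).aestronglyMeasurable
    (Filter.Eventually.of_forall fun w => norm_cutKernel_le hB0 hB (z, w))

theorem measurable_average [SFinite (ν₁.restrict W₁)] [SFinite (ν₂.restrict W₂)]
    (hK₁ : IsCompact K₁) (hK₂ : IsCompact K₂) (hW₁ : IsCompact W₁)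
    (hW₂ : IsCompact W₂) (hω : Measurable ω) {F : G₁ × G₂ → ℂ} (hF : Continuous F) :
    Measurable (average ν₁ ν₂ K₁ W₁ K₂ W₂ ω F) := by
  unfold average rect
  have h : Measurable fun a : (G₁ × G₂) × (G₁ × G₂) => cutKernel K₁ W₁ K₂ W₂ F a * ω a.2 :=
    (measurable_cutKernel hK₁ hK₂ hW₁ hW₂ hF).mul (hω.comp measurable_snd)
  exact h.stronglyMeasurable.integral_prod_right'.measurable

theorem norm_average_le (hω : Integrable ω (rect ν₁ ν₂ W₁ W₂)) {F : G₁ × G₂ → ℂ} {B : ℝ}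
    (hB0 : 0 ≤ B) (hB : ∀ z ∈ (K₁ - W₁) ×ˢ (K₂ - W₂), ‖F z‖ ≤ B) (z : G₁ × G₂) :
    ‖average ν₁ ν₂ K₁ W₁ K₂ W₂ ω F z‖ ≤ B * (oneNorm ν₁ ν₂ W₁ W₂ ω).toReal := by
  have e : (oneNorm ν₁ ν₂ W₁ W₂ ω).toReal = ∫ w, ‖ω w‖ ∂(rect ν₁ ν₂ W₁ W₂) :=
    (integral_norm_eq_lintegral_enorm hω.aestronglyMeasurable).symm
  rw [e, ← integral_const_mul]
  refine norm_integral_le_of_norm_le (hω.norm.const_mul B) (Filter.Eventually.of_forall fun w => ?_)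
  rw [norm_mul]
  gcongr
  exact norm_cutKernel_le hB0 hB (z, w)

theorem average_sub (hK₁ : IsCompact K₁) (hK₂ : IsCompact K₂) (hW₁ : IsCompact W₁)
    (hW₂ : IsCompact W₂) (hω : Integrable ω (rect ν₁ ν₂ W₁ W₂)) {F F' : G₁ × G₂ → ℂ}
    (hF : Continuous F) (hF' : Continuous F') {B B' : ℝ} (hB0 : 0 ≤ B) (hB0' : 0 ≤ B')
    (hB : ∀ z ∈ (K₁ - W₁) ×ˢ (K₂ - W₂), ‖F z‖ ≤ B)
    (hB' : ∀ z ∈ (K₁ - W₁) ×ˢ (K₂ - W₂), ‖F' z‖ ≤ B') (z : G₁ × G₂) :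
    average ν₁ ν₂ K₁ W₁ K₂ W₂ ω (F - F') z =
      average ν₁ ν₂ K₁ W₁ K₂ W₂ ω F z - average ν₁ ν₂ K₁ W₁ K₂ W₂ ω F' z := by
  unfold average
  rw [← integral_sub (integrable_cutKernel_mul hK₁ hK₂ hW₁ hW₂ hω hF hB0 hB z)
    (integrable_cutKernel_mul hK₁ hK₂ hW₁ hW₂ hω hF' hB0' hB' z)]
  congr 1
  ext w
  rw [← sub_mul]
  congr 1
  unfold cutKernel
  by_cases h : (z, w) ∈ (K₁ ×ˢ K₂) ×ˢ (W₁ ×ˢ W₂)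
  · simp only [Set.indicator_of_mem h, Pi.sub_apply]
  · simp only [Set.indicator_of_notMem h, sub_zero]

theorem average_smul (t : ℝ) (F : G₁ × G₂ → ℂ) (z : G₁ × G₂) :
    average ν₁ ν₂ K₁ W₁ K₂ W₂ ω (t • F) z = t * average ν₁ ν₂ K₁ W₁ K₂ W₂ ω F z := by
  unfold average
  rw [← integral_const_mul]
  congr 1
  ext w
  rw [← mul_assoc]
  congr 1
  unfold cutKernel
  by_cases h : (z, w) ∈ (K₁ ×ˢ K₂) ×ˢ (W₁ ×ˢ W₂)
  · simp only [Set.indicator_of_mem h, Pi.smul_apply, Complex.real_smul]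
  · simp only [Set.indicator_of_notMem h, mul_zero]

/-- On `K₁ × K₂`, the convolution of `f` with `ω` is the cut-off average of any continuous function
agreeing with `f` almost everywhere on `(K₁ - W₁) × (K₂ - W₂)`. -/
theorem conv_eq_average [IsFiniteMeasure (ν₁.restrict W₁)] [IsFiniteMeasure (ν₂.restrict W₂)]
    [SFinite (ν₂.restrict (K₂ - W₂))]
    [ν₁.IsAddLeftInvariant] [ν₁.IsNegInvariant] [ν₂.IsAddLeftInvariant] [ν₂.IsNegInvariant]
    (hK₁ : IsCompact K₁) (hK₂ : IsCompact K₂) (hW₁ : IsCompact W₁)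
    (hW₂ : IsCompact W₂) (hω : Integrable ω (rect ν₁ ν₂ W₁ W₂))
    (hωW : Function.support ω ⊆ W₁ ×ˢ W₂) {ω' : G₁ × G₂ → ℂ} (hω' : ω =ᵐ[rect ν₁ ν₂ W₁ W₂] ω')
    {f F : G₁ × G₂ → ℂ} (hF : Continuous F) {B : ℝ} (hB0 : 0 ≤ B)
    (hB : ∀ z ∈ (K₁ - W₁) ×ˢ (K₂ - W₂), ‖F z‖ ≤ B)
    (hfF : f =ᵐ[rect ν₁ ν₂ (K₁ - W₁) (K₂ - W₂)] F) {z : G₁ × G₂} (hz : z ∈ K₁ ×ˢ K₂) :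
    conv ν₁ ν₂ f ω z = average ν₁ ν₂ K₁ W₁ K₂ W₂ ω' F z := by
  have hω0 : ∀ u v, ¬ (u ∈ W₁ ∧ v ∈ W₂) → ω (u, v) = 0 := fun u v h => by
    by_contra hne
    exact h (hωW hne)
  have hKW₁ : MeasurableSet (K₁ - W₁) := by
    rw [sub_eq_add_neg]; exact (hK₁.add hW₁.neg).measurableSet
  have hKW₂ : MeasurableSet (K₂ - W₂) := by
    rw [sub_eq_add_neg]; exact (hK₂.add hW₂.neg).measurableSet
  -- The exceptional set in `K̃` is pulled back slice by slice along the measure-preserving maps `u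
  -- ↦ z.1 - u` and `v ↦ z.2 - v`.
  have h1 : ∀ᵐ u ∂ν₁, ∀ᵐ v ∂ν₂, f (z.1 - u, z.2 - v) * ω (u, v) =
      cutKernel K₁ W₁ K₂ W₂ F (z, (u, v)) * ω (u, v) := by
    have h2 := (ae_restrict_iff' hKW₁).1 (Measure.ae_ae_of_ae_prod hfF)
    have h3 := (Measure.measurePreserving_sub_left ν₁ z.1).quasiMeasurePreserving.ae h2
    filter_upwards [h3] with u hu
    by_cases huW : u ∈ W₁
    · have h4 := (ae_restrict_iff' hKW₂).1 (hu (Set.sub_mem_sub hz.1 huW))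
      have h5 := (Measure.measurePreserving_sub_left ν₂ z.2).quasiMeasurePreserving.ae h4
      filter_upwards [h5] with v hv
      by_cases hvW : v ∈ W₂
      · rw [hv (Set.sub_mem_sub hz.2 hvW)]
        congr 1
        exact (Set.indicator_of_mem (s := (K₁ ×ˢ K₂) ×ˢ (W₁ ×ˢ W₂)) (a := (z, (u, v)))
          ⟨hz, huW, hvW⟩ fun a : (G₁ × G₂) × (G₁ × G₂) => F (a.1 - a.2)).symm
      · rw [hω0 u v (fun h => hvW h.2), mul_zero, mul_zero]
    · refine Filter.Eventually.of_forall fun v => ?_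
      rw [hω0 u v (fun h => huW h.1), mul_zero, mul_zero]
  have h2 : conv ν₁ ν₂ f ω z =
      ∫ u, ∫ v, cutKernel K₁ W₁ K₂ W₂ F (z, (u, v)) * ω (u, v) ∂ν₂ ∂ν₁ := by
    unfold conv
    refine integral_congr_ae ?_
    filter_upwards [h1] with u hu using integral_congr_ae hu
  -- The Haar measures need not be `σ`-finite; Fubini becomes available after restriction to the
  -- compact `W₁` and `W₂`.
  have h3 : (∫ u, ∫ v, cutKernel K₁ W₁ K₂ W₂ F (z, (u, v)) * ω (u, v) ∂ν₂ ∂ν₁) =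
      ∫ u in W₁, ∫ v in W₂, cutKernel K₁ W₁ K₂ W₂ F (z, (u, v)) * ω (u, v) ∂ν₂ ∂ν₁ := by
    rw [setIntegral_eq_integral_of_forall_compl_eq_zero]
    · congr 1
      ext u
      rw [setIntegral_eq_integral_of_forall_compl_eq_zero]
      intro v hv
      rw [hω0 u v (fun h => hv h.2), mul_zero]
    · intro u hu
      have : ∀ v, cutKernel K₁ W₁ K₂ W₂ F (z, (u, v)) * ω (u, v) = 0 := fun v => by
        rw [hω0 u v (fun h => hu h.1), mul_zero]
      simp [this]
  rw [h2, h3, average]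
  have h4 := integral_prod (μ := ν₁.restrict W₁) (ν := ν₂.restrict W₂) _
    (integrable_cutKernel_mul hK₁ hK₂ hW₁ hW₂ hω hF hB0 hB z)
  rw [← h4]
  refine integral_congr_ae ?_
  filter_upwards [hω'] with w hw
  rw [hw]

/-- Translating by `w ∈ W₁` moves `K₁` into `K₁ - W₁`, and the measure is invariant. -/
theorem setLIntegral_sub_le [ν₁.IsAddRightInvariant] (hK₁ : MeasurableSet K₁)
    (hKW : MeasurableSet (K₁ - W₁)) (g : G₁ → ℝ≥0∞) {w : G₁} (hw : w ∈ W₁) :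
    ∫⁻ u in K₁, g (u - w) ∂ν₁ ≤ ∫⁻ u in K₁ - W₁, g u ∂ν₁ := by
  rw [← lintegral_indicator hK₁, ← lintegral_indicator hKW,
    ← lintegral_sub_right_eq_self ((K₁ - W₁).indicator g) w]
  refine lintegral_mono fun u => ?_
  by_cases hu : u ∈ K₁
  · rw [Set.indicator_of_mem hu, Set.indicator_of_mem (Set.sub_mem_sub hu hw)]
  · rw [Set.indicator_of_notMem hu]; exact bot_le

/-- Hölder's inequality for translates. -/
theorem oneNorm_translate_le [IsFiniteMeasure (ν₁.restrict K₁)] [IsFiniteMeasure (ν₂.restrict K₂)]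
    [ν₁.IsAddRightInvariant] [ν₂.IsAddRightInvariant]
    (hK₁ : IsCompact K₁) (hK₂ : IsCompact K₂) (hW₁ : IsCompact W₁) (hW₂ : IsCompact W₂)
    {p q : ℝ} (hp : 1 < p) (hq : 1 < q) {F : G₁ × G₂ → ℂ} (hF : Measurable F) {w : G₁ × G₂}
    (hw : w ∈ W₁ ×ˢ W₂) :
    oneNorm ν₁ ν₂ K₁ K₂ (fun z => F (z - w)) ≤
      mixedNorm ν₁ ν₂ p q (K₁ - W₁) (K₂ - W₂) F *
        (ν₁ K₁ ^ ((p - 1) / p) * ν₂ K₂ ^ ((q - 1) / q)) := by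
  have hKW₁ : MeasurableSet (K₁ - W₁) := by
    rw [sub_eq_add_neg]; exact (hK₁.add hW₁.neg).measurableSet
  have hKW₂ : MeasurableSet (K₂ - W₂) := by
    rw [sub_eq_add_neg]; exact (hK₂.add hW₂.neg).measurableSet
  have hFw : Measurable fun z : G₁ × G₂ => ‖F (z - w)‖ₑ := by
    have : Measurable fun z : G₁ × G₂ => z - w :=
      (measurable_fst.sub_const w.1).prodMk (measurable_snd.sub_const w.2)
    exact (hF.comp this).enorm
  have hp0 : 0 < p := by linarith
  have hq0 : 0 < q := by linarith
  unfold oneNorm rect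
  rw [lintegral_prod _ hFw.aemeasurable]
  set g : G₁ → ℝ≥0∞ := fun u => ∫⁻ v in K₂ - W₂, ‖F (u, v)‖ₑ ^ q ∂ν₂ with hg
  set g' : G₁ → ℝ≥0∞ := fun u => ∫⁻ v in K₂, ‖F ((u, v) - w)‖ₑ ^ q ∂ν₂ with hg'
  have hg'm : Measurable g' := (hFw.pow_const q).lintegral_prod_right'
  have hgg : ∀ u, g' u ≤ g (u - w.1) := fun u =>
    setLIntegral_sub_le hK₂.measurableSet hKW₂ (fun v => ‖F (u - w.1, v)‖ₑ ^ q) hw.2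
  calc ∫⁻ u in K₁, ∫⁻ v in K₂, ‖F ((u, v) - w)‖ₑ ∂ν₂ ∂ν₁
      ≤ ∫⁻ u in K₁, g' u ^ (1 / q) * ν₂ K₂ ^ ((q - 1) / q) ∂ν₁ := by
        refine lintegral_mono fun u => ?_
        have := lintegral_le_rpow_mul (ν₂.restrict K₂) hq
          (g := fun v => ‖F ((u, v) - w)‖ₑ) (hFw.comp measurable_prodMk_left).aemeasurable
        rwa [Measure.restrict_apply_univ] at this
    _ = (∫⁻ u in K₁, g' u ^ (1 / q) ∂ν₁) * ν₂ K₂ ^ ((q - 1) / q) :=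
        lintegral_mul_const _ (hg'm.pow_const _)
    _ ≤ ((∫⁻ u in K₁, (g' u ^ (1 / q)) ^ p ∂ν₁) ^ (1 / p) * ν₁ K₁ ^ ((p - 1) / p)) *
          ν₂ K₂ ^ ((q - 1) / q) := by
        gcongr
        have := lintegral_le_rpow_mul (ν₁.restrict K₁) hp (hg'm.pow_const (1 / q)).aemeasurable
        rwa [Measure.restrict_apply_univ] at this
    _ ≤ (mixedNorm ν₁ ν₂ p q (K₁ - W₁) (K₂ - W₂) F * ν₁ K₁ ^ ((p - 1) / p)) *
          ν₂ K₂ ^ ((q - 1) / q) := by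
        gcongr
        unfold mixedNorm
        refine ENNReal.rpow_le_rpow ?_ (by positivity)
        calc ∫⁻ u in K₁, (g' u ^ (1 / q)) ^ p ∂ν₁ ≤ ∫⁻ u in K₁, g (u - w.1) ^ (p / q) ∂ν₁ := by
              refine lintegral_mono fun u => ?_
              rw [← ENNReal.rpow_mul, one_div_mul_eq_div]
              gcongr
              exact hgg u
          _ ≤ _ := setLIntegral_sub_le hK₁.measurableSet hKW₁ (fun u => g u ^ (p / q)) hw.1
    _ = _ := by ring

/-- Young's inequality on compact rectangles. -/
theorem oneNorm_average_le [IsFiniteMeasure (ν₁.restrict K₁)] [IsFiniteMeasure (ν₂.restrict K₂)]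
    [IsFiniteMeasure (ν₁.restrict W₁)] [IsFiniteMeasure (ν₂.restrict W₂)]
    [ν₁.IsAddRightInvariant] [ν₂.IsAddRightInvariant]
    (hK₁ : IsCompact K₁) (hK₂ : IsCompact K₂) (hW₁ : IsCompact W₁) (hW₂ : IsCompact W₂)
    {p q : ℝ} (hp : 1 < p) (hq : 1 < q) (hω : Measurable ω) {F : G₁ × G₂ → ℂ} (hF : Continuous F)
    (hFm : Measurable F) :
    oneNorm ν₁ ν₂ K₁ K₂ (average ν₁ ν₂ K₁ W₁ K₂ W₂ ω F) ≤
      oneNorm ν₁ ν₂ W₁ W₂ ω * (mixedNorm ν₁ ν₂ p q (K₁ - W₁) (K₂ - W₂) F *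
        (ν₁ K₁ ^ ((p - 1) / p) * ν₂ K₂ ^ ((q - 1) / q))) := by
  have hcm := measurable_cutKernel hK₁ hK₂ hW₁ hW₂ hF
  have hm : Measurable fun a : (G₁ × G₂) × (G₁ × G₂) =>
      ‖cutKernel K₁ W₁ K₂ W₂ F a‖ₑ * ‖ω a.2‖ₑ :=
    hcm.enorm.mul (hω.comp measurable_snd).enorm
  calc oneNorm ν₁ ν₂ K₁ K₂ (average ν₁ ν₂ K₁ W₁ K₂ W₂ ω F)
      ≤ ∫⁻ z, ∫⁻ w, ‖cutKernel K₁ W₁ K₂ W₂ F (z, w)‖ₑ * ‖ω w‖ₑ ∂(rect ν₁ ν₂ W₁ W₂)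
          ∂(rect ν₁ ν₂ K₁ K₂) := by
        refine lintegral_mono fun z => ?_
        refine (enorm_integral_le_lintegral_enorm _).trans_eq ?_
        simp_rw [enorm_mul]
    _ = ∫⁻ w, ∫⁻ z, ‖cutKernel K₁ W₁ K₂ W₂ F (z, w)‖ₑ * ‖ω w‖ₑ ∂(rect ν₁ ν₂ K₁ K₂)
          ∂(rect ν₁ ν₂ W₁ W₂) := by
        unfold rect
        exact lintegral_lintegral_swap hm.aemeasurable
    _ ≤ ∫⁻ w, (mixedNorm ν₁ ν₂ p q (K₁ - W₁) (K₂ - W₂) F *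
          (ν₁ K₁ ^ ((p - 1) / p) * ν₂ K₂ ^ ((q - 1) / q))) * ‖ω w‖ₑ ∂(rect ν₁ ν₂ W₁ W₂) := by
        refine lintegral_mono_ae ?_
        filter_upwards [ae_rect_mem (ν₁ := ν₁) (ν₂ := ν₂) hW₁.measurableSet hW₂.measurableSet]
          with w hw
        rw [lintegral_mul_const _ (f := fun z => ‖cutKernel K₁ W₁ K₂ W₂ F (z, w)‖ₑ)
          (hcm.comp measurable_prodMk_right).enorm]
        gcongr
        refine le_trans ?_ (oneNorm_translate_le hK₁ hK₂ hW₁ hW₂ hp hq hFm hw)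
        refine lintegral_mono fun z => ?_
        unfold cutKernel
        by_cases h : (z, w) ∈ (K₁ ×ˢ K₂) ×ˢ (W₁ ×ˢ W₂)
        · rw [Set.indicator_of_mem h]
        · rw [Set.indicator_of_notMem h]; simp
    _ = _ := by
        rw [lintegral_const_mul _ hω.enorm, mul_comm]; rfl

end

end Average

/-! ### Finiteness of separated families, sequence norms and compact supports. -/

section Separation

variable {G I : Type*} [AddCommGroup G] [TopologicalSpace G] [IsTopologicalAddGroup G]

/-- A separated family has only finitely many members in a compact set. -/
theorem IsSeparated.finite_preimage {x : I → G} (hx : IsSeparated x) {Q : Set G}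
    (hQ : IsCompact Q) : {s | x s ∈ Q}.Finite := by
  obtain ⟨U, hU, hd⟩ := hx
  obtain ⟨t, -, ht⟩ := hQ.elim_nhds_subcover (fun g => (fun h => g + h) '' U) (fun g _ => by
    have := (Homeomorph.addLeft g).isOpenMap.image_mem_nhds hU
    simpa using this)
  refine (t.finite_toSet.biUnion (t := fun g => {s | x s ∈ (fun h => g + h) '' U})
    fun g _ => ?_).subset fun s hs => ?_
  -- A translate `g + U` holds at most one node: `x s = g + u` and `x s' = g + u'` give `x s + u' =
  -- x s' + u`, a common point of two disjoint translates.
  · refine Set.Subsingleton.finite ?_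
    rintro s ⟨u, hu, hus⟩ s' ⟨u', hu', hus'⟩
    by_contra hne
    refine Set.disjoint_left.1 (hd s s' hne) ⟨u', hu', rfl⟩ ⟨u, hu, ?_⟩
    simp only at hus hus' ⊢
    rw [← hus, ← hus']; abel
  · simpa using ht hs

end Separation

section SeqNorm

variable {I : Type*}

theorem enorm_le_seqNorm {p q : ℝ} (hp : 0 < p) (hq : 0 < q) (c : I → I → ℂ) (s t : I) :
    ‖c s t‖ₑ ≤ seqNorm p q c := by
  unfold seqNorm
  calc ‖c s t‖ₑ = ((‖c s t‖ₑ ^ q) ^ (p / q)) ^ (1 / p) := by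
        rw [← ENNReal.rpow_mul, ← ENNReal.rpow_mul]
        have : q * (p / q * (1 / p)) = 1 := by field_simp
        rw [this, ENNReal.rpow_one]
    _ ≤ ((∑' t, ‖c s t‖ₑ ^ q) ^ (p / q)) ^ (1 / p) := by
        gcongr
        exact ENNReal.le_tsum (f := fun t => ‖c s t‖ₑ ^ q) t
    _ ≤ _ := by
        gcongr
        exact ENNReal.le_tsum (f := fun s => (∑' t, ‖c s t‖ₑ ^ q) ^ (p / q)) s

theorem seqNorm_lt_top {p q : ℝ} (hp : 0 < p) (hq : 0 < q) {c : I → I → ℂ} {T : Set (I × I)}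
    (hT : T.Finite) (hc : ∀ s t, (s, t) ∉ T → c s t = 0) : seqNorm p q c < ∞ := by
  have hpq : 0 < p / q := by positivity
  have hinner : ∀ s, ∑' t, ‖c s t‖ₑ ^ q < ∞ := by
    intro s
    rw [tsum_eq_sum (s := (hT.image Prod.snd).toFinset)]
    · exact ENNReal.sum_lt_top.2 fun t _ => ENNReal.rpow_lt_top_of_nonneg hq.le enorm_ne_top
    · intro t ht
      have : (s, t) ∉ T := fun h => ht (by simpa using ⟨s, h⟩)
      rw [hc s t this, enorm_zero, ENNReal.zero_rpow_of_pos hq]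
  unfold seqNorm
  refine ENNReal.rpow_lt_top_of_nonneg (by positivity) ?_
  rw [tsum_eq_sum (s := (hT.image Prod.fst).toFinset)]
  · exact (ENNReal.sum_lt_top.2 fun s _ =>
      ENNReal.rpow_lt_top_of_nonneg hpq.le (hinner s).ne).ne
  · intro s hs
    have : ∀ t, ‖c s t‖ₑ ^ q = 0 := fun t => by
      have : (s, t) ∉ T := fun h => hs (by simpa using ⟨t, h⟩)
      rw [hc s t this, enorm_zero, ENNReal.zero_rpow_of_pos hq]
    simp [this, hpq]

end SeqNorm

section Bounded

variable {G₁ G₂ : Type*} [MeasurableSpace G₁] [TopologicalSpace G₁] [T2Space G₁]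
  [OpensMeasurableSpace G₁] [MeasurableSpace G₂] [TopologicalSpace G₂] [T2Space G₂]
  [OpensMeasurableSpace G₂]

/-- Guarantees that every finite combination of shifts has finite global mixed norm, hence really
belongs to `V_K(Φ)`. -/
theorem memMixed_of_hasCompactSupport {ν₁ : Measure G₁} {ν₂ : Measure G₂}
    [IsFiniteMeasureOnCompacts ν₁] [IsFiniteMeasureOnCompacts ν₂] {p q : ℝ} (hp : 0 < p)
    (hq : 0 < q) {F : G₁ × G₂ → ℂ} (hFm : Measurable F) (hF : Continuous F)
    (hFs : HasCompactSupport F) : MemMixed ν₁ ν₂ p q F := by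
  refine ⟨hFm, ?_⟩
  obtain ⟨M, hM⟩ := hFs.exists_bound_of_continuous hF
  have hA : IsCompact (Prod.fst '' tsupport F) := hFs.isCompact.image continuous_fst
  have hB : IsCompact (Prod.snd '' tsupport F) := hFs.isCompact.image continuous_snd
  have hF0 : ∀ u v, ¬ (u ∈ Prod.fst '' tsupport F ∧ v ∈ Prod.snd '' tsupport F) →
      F (u, v) = 0 := fun u v h => by
    by_contra hne
    have := subset_tsupport F hne
    exact h ⟨⟨_, this, rfl⟩, ⟨_, this, rfl⟩⟩
  have hpq : 0 < p / q := by positivity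
  set D : ℝ≥0∞ := (ENNReal.ofReal M ^ q * ν₂ (Prod.snd '' tsupport F)) ^ (p / q) with hD
  have hDtop : D ≠ ∞ := by
    refine (ENNReal.rpow_lt_top_of_nonneg hpq.le (ENNReal.mul_ne_top ?_ hB.measure_lt_top.ne)).ne
    exact (ENNReal.rpow_lt_top_of_nonneg hq.le ENNReal.ofReal_ne_top).ne
  unfold mixedNorm
  simp only [Measure.restrict_univ]
  refine ENNReal.rpow_lt_top_of_nonneg (by positivity) (ne_of_lt ?_)
  calc ∫⁻ u, (∫⁻ v, ‖F (u, v)‖ₑ ^ q ∂ν₂) ^ (p / q) ∂ν₁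
      ≤ ∫⁻ u, (Prod.fst '' tsupport F).indicator (fun _ => D) u ∂ν₁ := by
        refine lintegral_mono fun u => ?_
        by_cases hu : u ∈ Prod.fst '' tsupport F
        · rw [Set.indicator_of_mem hu, hD]
          gcongr
          calc ∫⁻ v, ‖F (u, v)‖ₑ ^ q ∂ν₂ ≤ ∫⁻ v, (Prod.snd '' tsupport F).indicator
                (fun _ => ENNReal.ofReal M ^ q) v ∂ν₂ := by
                refine lintegral_mono fun v => ?_
                by_cases hv : v ∈ Prod.snd '' tsupport F
                · rw [Set.indicator_of_mem hv, ← ofReal_norm]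
                  gcongr
                  exact hM _
                · rw [Set.indicator_of_notMem hv, hF0 u v (fun h => hv h.2), enorm_zero,
                    ENNReal.zero_rpow_of_pos hq]
            _ = _ := lintegral_indicator_const hB.measurableSet _
        · rw [Set.indicator_of_notMem hu]
          simp [hF0 u _ (fun h => hu h.1), hq, hpq]
    _ = D * ν₁ (Prod.fst '' tsupport F) := lintegral_indicator_const hA.measurableSet _
    _ < ∞ := ENNReal.mul_lt_top hDtop.lt_top hA.measure_lt_top

end Bounded

theorem hasCompactSupport_finset_sum {X κ : Type*} [TopologicalSpace X] (J : Finset κ)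
    (g : κ → X → ℂ) (h : ∀ j ∈ J, HasCompactSupport (g j)) :
    HasCompactSupport (fun z => ∑ j ∈ J, g j z) := by
  classical
  induction J using Finset.induction_on with
  | empty => exact HasCompactSupport.zero
  | insert a J ha ih =>
    simp_rw [Finset.sum_insert ha]
    exact (h a (Finset.mem_insert_self _ _)).add
      (ih fun j hj => h j (Finset.mem_insert_of_mem hj))

/-! ### Finite-dimensional parametrization of `V_K(Φ)`. -/

section Trial

variable {G₁ G₂ : Type*} [AddCommGroup G₁] [AddCommGroup G₂] {I : Type*} {r : ℕ}

/-- The indices of the shifts of `Φ` that do not vanish identically on `A × B`. -/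
def activeShifts (x : I → G₁) (y : I → G₂) (φ : Fin r → G₁ × G₂ → ℂ) (A : Set G₁) (B : Set G₂) :
    Set (I × I) :=
  {st | ∃ z ∈ A ×ˢ B, ∃ i, φ i (z.1 - x st.1, z.2 - y st.2) ≠ 0}

/-- The linear combination of finitely many shifts of `Φ` with given coefficients. -/
def shiftSum (x : I → G₁) (y : I → G₂) (φ : Fin r → G₁ × G₂ → ℂ) (T : Set (I × I)) [Fintype T]
    (c : Fin r → T → ℂ) (z : G₁ × G₂) : ℂ :=
  ∑ st : T, ∑ i, c i st * φ i (z.1 - x st.1.1, z.2 - y st.1.2)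

open Classical in
/-- Extension of a coefficient family by zero. -/
noncomputable def extendCoeff (T : Set (I × I)) (c : Fin r → T → ℂ) (i : Fin r) (s t : I) : ℂ :=
  if h : (s, t) ∈ T then c i ⟨(s, t), h⟩ else 0

theorem extendCoeff_of_notMem {T : Set (I × I)} (c : Fin r → T → ℂ) (i : Fin r) {s t : I}
    (h : (s, t) ∉ T) : extendCoeff T c i s t = 0 := dif_neg h

theorem extendCoeff_coe {T : Set (I × I)} (c : Fin r → T → ℂ) (i : Fin r) (st : T) :
    extendCoeff T c i st.1.1 st.1.2 = c i st := dif_pos st.2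

variable {x : I → G₁} {y : I → G₂} {φ : Fin r → G₁ × G₂ → ℂ} {A : Set G₁} {B : Set G₂}

theorem eq_zero_of_notMem_activeShifts {st : I × I} (h : st ∉ activeShifts x y φ A B)
    {z : G₁ × G₂} (hz : z ∈ A ×ˢ B) (i : Fin r) : φ i (z.1 - x st.1, z.2 - y st.2) = 0 := by
  by_contra hne
  exact h ⟨z, hz, i, hne⟩

theorem synth_eq_shiftSum [Fintype (activeShifts x y φ A B)] (c : Fin r → I → I → ℂ)
    {z : G₁ × G₂} (hz : z ∈ A ×ˢ B) :
    synth x y φ c z =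
      shiftSum x y φ (activeShifts x y φ A B) (fun i st => c i st.1.1 st.1.2) z := by
  unfold synth shiftSum
  rw [← tsum_fintype (L := SummationFilter.unconditional _), tsum_subtype (activeShifts x y φ A B)
    (fun st : I × I => ∑ i, c i st.1 st.2 * φ i (z.1 - x st.1, z.2 - y st.2))]
  congr 1
  ext st
  by_cases h : st ∈ activeShifts x y φ A B
  · rw [Set.indicator_of_mem h]
  · rw [Set.indicator_of_notMem h]
    refine Finset.sum_eq_zero fun i _ => ?_
    rw [eq_zero_of_notMem_activeShifts h hz i, mul_zero]

theorem synth_extendCoeff {T : Set (I × I)} [Fintype T] (c : Fin r → T → ℂ) :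
    synth x y φ (extendCoeff T c) = shiftSum x y φ T c := by
  ext z
  unfold synth shiftSum
  have h1 : ∀ st : T, ∑ i, c i st * φ i (z.1 - x st.1.1, z.2 - y st.1.2) =
      (fun st : I × I => ∑ i, extendCoeff T c i st.1 st.2 *
        φ i (z.1 - x st.1, z.2 - y st.2)) st := fun st => by
    simp only [extendCoeff_coe]
  simp_rw [h1]
  rw [← tsum_fintype (L := SummationFilter.unconditional _), tsum_subtype T
    (fun st : I × I => ∑ i, extendCoeff T c i st.1 st.2 * φ i (z.1 - x st.1, z.2 - y st.2))]
  congr 1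
  ext st
  by_cases h : st ∈ T
  · rw [Set.indicator_of_mem h]
  · rw [Set.indicator_of_notMem h]
    refine Finset.sum_eq_zero fun i _ => ?_
    rw [extendCoeff_of_notMem c i h, zero_mul]

theorem shiftSum_sub {T : Set (I × I)} [Fintype T] (c c' : Fin r → T → ℂ) :
    shiftSum x y φ T (c - c') = shiftSum x y φ T c - shiftSum x y φ T c' := by
  ext z
  simp only [shiftSum, Pi.sub_apply, sub_mul, Finset.sum_sub_distrib]

theorem shiftSum_add {T : Set (I × I)} [Fintype T] (c c' : Fin r → T → ℂ) :
    shiftSum x y φ T (c + c') = shiftSum x y φ T c + shiftSum x y φ T c' := by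
  ext z
  simp only [shiftSum, Pi.add_apply, add_mul, Finset.sum_add_distrib]

theorem shiftSum_smul {T : Set (I × I)} [Fintype T] (a : ℝ) (c : Fin r → T → ℂ) :
    shiftSum x y φ T (a • c) = a • shiftSum x y φ T c := by
  ext z
  simp only [shiftSum, Pi.smul_apply, Complex.real_smul, Finset.mul_sum, mul_assoc]

theorem CPhi_nonneg : 0 ≤ CPhi x y φ A B := by
  refine Real.sSup_nonneg ?_
  rintro _ ⟨z, -, rfl⟩
  exact Finset.sum_nonneg fun i _ => tsum_nonneg fun _ => norm_nonneg _

section Topological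

variable [TopologicalSpace G₁] [IsTopologicalAddGroup G₁] [TopologicalSpace G₂]
  [IsTopologicalAddGroup G₂]

/-- An active shift has its nodes in the compact sets `A - pr₁ (supp φ i)` and `B - pr₂ (supp φ i)`
for some `i`. -/
theorem finite_activeShifts (hx : IsSeparated x) (hy : IsSeparated y)
    (hφs : ∀ i, HasCompactSupport (φ i)) (hA : IsCompact A) (hB : IsCompact B) :
    (activeShifts x y φ A B).Finite := by
  have h1 : ∀ i, IsCompact (A + -(Prod.fst '' tsupport (φ i))) := fun i =>
    hA.add ((hφs i).isCompact.image continuous_fst).neg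
  have h2 : ∀ i, IsCompact (B + -(Prod.snd '' tsupport (φ i))) := fun i =>
    hB.add ((hφs i).isCompact.image continuous_snd).neg
  refine (Set.finite_iUnion fun i =>
    (hx.finite_preimage (h1 i)).prod (hy.finite_preimage (h2 i))).subset ?_
  rintro ⟨s, t⟩ ⟨z, hz, i, hne⟩
  have hmem := subset_tsupport (φ i) hne
  refine Set.mem_iUnion.2 ⟨i, ?_, ?_⟩
  · refine ⟨z.1, hz.1, -(z.1 - x s), ?_, by simp⟩
    simpa using ⟨_, hmem⟩
  · refine ⟨z.2, hz.2, -(z.2 - y t), ?_, by simp⟩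
    simpa using ⟨_, hmem⟩

theorem continuous_shiftSum (hφc : ∀ i, Continuous (φ i)) {T : Set (I × I)} [Fintype T]
    (c : Fin r → T → ℂ) : Continuous (shiftSum x y φ T c) := by
  unfold shiftSum
  refine continuous_finsetSum _ fun st _ => continuous_finsetSum _ fun i _ => ?_
  exact continuous_const.mul ((hφc i).comp (by fun_prop))

theorem hasCompactSupport_shiftSum (hφs : ∀ i, HasCompactSupport (φ i)) {T : Set (I × I)}
    [Fintype T] (c : Fin r → T → ℂ) : HasCompactSupport (shiftSum x y φ T c) := by
  have hterm : ∀ (st : T) (i : Fin r), HasCompactSupport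
      (fun z : G₁ × G₂ => c i st * φ i (z.1 - x st.1.1, z.2 - y st.1.2)) := fun st i =>
    ((hφs i).comp_homeomorph
      ((Homeomorph.subRight (x st.1.1)).prodCongr (Homeomorph.subRight (y st.1.2)))).mul_left
  unfold shiftSum
  exact hasCompactSupport_finset_sum _ _ fun st _ =>
    hasCompactSupport_finset_sum _ _ fun i _ => hterm st i

/-- The real supremum `CPhi` is meaningful only for a bounded set. On `A × B` the series reduce to a
finite sum over active shifts, which is continuous and so bounded on the compact rectangle. -/
theorem norm_shiftSum_le (hφc : ∀ i, Continuous (φ i)) (hA : IsCompact A) (hB : IsCompact B)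
    [Fintype (activeShifts x y φ A B)] (c : Fin r → activeShifts x y φ A B → ℂ)
    {z : G₁ × G₂} (hz : z ∈ A ×ˢ B) :
    ‖shiftSum x y φ (activeShifts x y φ A B) c z‖ ≤ CPhi x y φ A B * ‖c‖ := by
  let g : G₁ × G₂ → ℝ := fun z => ∑ i, ∑ st : (activeShifts x y φ A B), ‖φ i (z.1 - x st.1.1, z.2 - y st.1.2)‖
  have hg : Continuous g := continuous_finsetSum _ fun i _ => continuous_finsetSum _ fun st _ =>
    ((hφc i).comp (by fun_prop)).norm
  have hgC : ∀ z ∈ A ×ˢ B, ∑ i, ∑' st : I × I, ‖φ i (z.1 - x st.1, z.2 - y st.2)‖ = g z := by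
    intro z hz
    refine Finset.sum_congr rfl fun i _ => ?_
    rw [← tsum_fintype (L := SummationFilter.unconditional _),
      tsum_subtype (activeShifts x y φ A B) (fun st : I × I => ‖φ i (z.1 - x st.1, z.2 - y st.2)‖)]
    congr 1
    ext st
    by_cases h : st ∈ (activeShifts x y φ A B)
    · rw [Set.indicator_of_mem h]
    · rw [Set.indicator_of_notMem h, eq_zero_of_notMem_activeShifts h hz i, norm_zero]
  have hle : g z ≤ CPhi x y φ A B := by
    unfold CPhi
    rw [Set.image_congr hgC]
    exact le_csSup ((hA.prod hB).image hg).bddAbove ⟨z, hz, rfl⟩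
  calc ‖shiftSum x y φ (activeShifts x y φ A B) c z‖
      ≤ ∑ st : (activeShifts x y φ A B), ∑ i, ‖c‖ * ‖φ i (z.1 - x st.1.1, z.2 - y st.1.2)‖ := by
        unfold shiftSum
        refine (norm_sum_le _ _).trans (Finset.sum_le_sum fun st _ => (norm_sum_le _ _).trans
          (Finset.sum_le_sum fun i _ => ?_))
        rw [norm_mul]
        gcongr
        exact (norm_le_pi_norm (c i) st).trans (norm_le_pi_norm c i)
    _ = g z * ‖c‖ := by
        rw [Finset.sum_comm, mul_comm, Finset.mul_sum]
        exact Finset.sum_congr rfl fun i _ => (Finset.mul_sum _ _ _).symm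
    _ ≤ _ := by gcongr

end Topological

section Measure

variable [MeasurableSpace G₁] [MeasurableSpace G₂] {ν₁ : Measure G₁} {ν₂ : Measure G₂} {p q : ℝ}

theorem measurable_shiftSum [MeasurableSub G₁] [MeasurableSub G₂] (hφm : ∀ i, Measurable (φ i))
    {T : Set (I × I)} [Fintype T] (c : Fin r → T → ℂ) : Measurable (shiftSum x y φ T c) := by
  unfold shiftSum
  refine Finset.measurable_fun_sum _ fun st _ => Finset.measurable_fun_sum _ fun i _ => ?_
  exact ((hφm i).comp ((measurable_fst.sub_const _).prodMk (measurable_snd.sub_const _))).const_mul _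

/-- Stability bounds the largest coefficient by the mixed norm. -/
theorem StableShifts.mul_norm_le {a₁ a₂ : ℝ} (hΦ : StableShifts ν₁ ν₂ p q x y φ A B a₁ a₂)
    (ha₁ : 0 < a₁) (hp : 0 < p) (hq : 0 < q) [Fintype (activeShifts x y φ A B)]
    (c : Fin r → activeShifts x y φ A B → ℂ)
    (hfin : mixedNorm ν₁ ν₂ p q A B (shiftSum x y φ (activeShifts x y φ A B) c) ≠ ∞) :
    a₁ * ‖c‖ ≤ (mixedNorm ν₁ ν₂ p q A B (shiftSum x y φ (activeShifts x y φ A B) c)).toReal := by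
  have h := (hΦ (extendCoeff _ c)
    (fun i => seqNorm_lt_top hp hq (Set.toFinite (activeShifts x y φ A B))
      fun s t hst => extendCoeff_of_notMem c i hst)
    (fun s t hst i => extendCoeff_of_notMem c i (by
      rintro ⟨z, hz, j, hne⟩; exact hne (hst z hz j)))).1
  rw [synth_extendCoeff] at h
  rw [mul_comm, ← le_div_iff₀ ha₁]
  refine (pi_norm_le_iff_of_nonneg (by positivity)).2 fun i =>
    (pi_norm_le_iff_of_nonneg (by positivity)).2 fun st => ?_
  rw [le_div_iff₀ ha₁, mul_comm]
  have h2 : ENNReal.ofReal a₁ * ‖c i st‖ₑ ≤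
      mixedNorm ν₁ ν₂ p q A B (shiftSum x y φ (activeShifts x y φ A B) c) := by
    refine le_trans ?_ h
    gcongr
    rw [← extendCoeff_coe c i st]
    refine (enorm_le_seqNorm hp hq _ _ _).trans ?_
    exact Finset.single_le_sum (f := fun i => seqNorm p q (extendCoeff _ c i))
      (fun _ _ => bot_le) (Finset.mem_univ i)
  have h3 := ENNReal.toReal_mono hfin h2
  rwa [ENNReal.toReal_mul, ENNReal.toReal_ofReal ha₁.le, toReal_enorm] at h3

theorem exists_shiftSum_of_mem_VK [Fintype (activeShifts x y φ A B)] (hA : MeasurableSet A)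
    (hB : MeasurableSet B) {f : G₁ × G₂ → ℂ} (hf : f ∈ VK ν₁ ν₂ p q x y φ A B) :
    ∃ c, f =ᵐ[rect ν₁ ν₂ A B] shiftSum x y φ (activeShifts x y φ A B) c := by
  obtain ⟨-, c, -, hc⟩ := hf
  refine ⟨fun i st => c i st.1.1 st.1.2, ?_⟩
  filter_upwards [hc, ae_rect_mem (ν₁ := ν₁) (ν₂ := ν₂) hA hB] with z hz hzm
  rw [hz, synth_eq_shiftSum c hzm]

theorem shiftSum_mem_VK (hp : 0 < p) (hq : 0 < q) {T : Set (I × I)} [Fintype T]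
    (c : Fin r → T → ℂ) (hc : MemMixed ν₁ ν₂ p q (shiftSum x y φ T c)) :
    shiftSum x y φ T c ∈ VK ν₁ ν₂ p q x y φ A B :=
  ⟨hc, extendCoeff T c, fun i => seqNorm_lt_top hp hq (Set.toFinite T)
    fun _ _ hst => extendCoeff_of_notMem c i hst, by rw [synth_extendCoeff]⟩

/-- The dimension of `V_K(Φ)` is the number of real coefficients of the active shifts. -/
theorem finrank_eq_dimVK [Fintype (activeShifts x y φ A B)] [SFinite (ν₂.restrict B)]
    (hA : MeasurableSet A) (hB : MeasurableSet B) (hp : 0 < p) (hq : 0 < q)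
    (hmem : ∀ c, MemMixed ν₁ ν₂ p q (shiftSum x y φ (activeShifts x y φ A B) c))
    {a₁ a₂ : ℝ} (ha₁ : 0 < a₁) (hΦ : StableShifts ν₁ ν₂ p q x y φ A B a₁ a₂) :
    Module.finrank ℝ (Fin r → activeShifts x y φ A B → ℂ) = dimVK ν₁ ν₂ p q x y φ A B := by
  let Λ : (Fin r → (activeShifts x y φ A B) → ℂ) →ₗ[ℝ] ((G₁ × G₂) →ₘ[rect ν₁ ν₂ A B] ℂ) :=
    { toFun := fun c => AEEqFun.mk (shiftSum x y φ (activeShifts x y φ A B) c) (hmem c).1.aestronglyMeasurable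
      map_add' := fun c c' => by
        rw [AEEqFun.mk_add_mk]
        congr 1
        exact shiftSum_add c c'
      map_smul' := fun a c => by
        rw [RingHom.id_apply, AEEqFun.smul_mk]
        congr 1
        exact shiftSum_smul a c }
  have hrange : {g : (G₁ × G₂) →ₘ[rect ν₁ ν₂ A B] ℂ |
      ∃ f ∈ VK ν₁ ν₂ p q x y φ A B, (g : G₁ × G₂ → ℂ) =ᵐ[rect ν₁ ν₂ A B] f} =
      (LinearMap.range Λ : Set _) := by
    ext g
    constructor
    · rintro ⟨f, hf, hgf⟩
      obtain ⟨c, hc⟩ := exists_shiftSum_of_mem_VK hA hB hf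
      refine ⟨c, AEEqFun.ext ?_⟩
      exact (AEEqFun.coeFn_mk _ _).trans (hgf.trans hc).symm
    · rintro ⟨c, rfl⟩
      exact ⟨_, shiftSum_mem_VK hp hq c (hmem c), AEEqFun.coeFn_mk _ _⟩
  -- A combination vanishing almost everywhere has mixed norm zero, so stability forces its
  -- coefficients to vanish.
  have hinj : Function.Injective Λ := by
    rw [← LinearMap.ker_eq_bot, LinearMap.ker_eq_bot']
    intro c hc
    have h1 : shiftSum x y φ (activeShifts x y φ A B) c =ᵐ[rect ν₁ ν₂ A B] fun _ => (0 : ℂ) :=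
      AEEqFun.mk_eq_mk.1 (hc : AEEqFun.mk _ _ = AEEqFun.mk (fun _ => (0 : ℂ)) _)
    have h2 : mixedNorm ν₁ ν₂ p q A B (shiftSum x y φ (activeShifts x y φ A B) c) = 0 := by
      rw [mixedNorm_congr_ae p q h1]
      simp [mixedNorm, hp, hq, div_pos hp hq]
    have h3 := hΦ.mul_norm_le ha₁ hp hq c (by rw [h2]; simp)
    rw [h2, ENNReal.toReal_zero] at h3
    exact norm_le_zero_iff.1 (nonpos_of_mul_nonpos_right h3 ha₁)
  unfold dimVK
  rw [hrange, Submodule.span_eq, LinearMap.finrank_range_of_inj hinj]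

end Measure

end Trial

/-! ### Expectations under a bounded density. -/

section Density

variable {G₁ G₂ : Type*} [MeasurableSpace G₁] [MeasurableSpace G₂] {ν₁ : Measure G₁}
  {ν₂ : Measure G₂} {K₁ : Set G₁} {K₂ : Set G₂} {S : Type*} [MeasurableSpace S] {P : Measure S}

/-- The expectation of `‖H(Z)‖` for a random point `Z` with density between `C₁` and `C₂` is
comparable to the `L¹` norm of `H`. -/
theorem integral_norm_comp_mem_Icc (hK₁ : MeasurableSet K₁) (hK₂ : MeasurableSet K₂)
    {ρ : G₁ × G₂ → ℝ} (hρm : Measurable ρ) {C₁ C₂ : ℝ} (hC₁ : 0 ≤ C₁) (hC₂ : 0 ≤ C₂)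
    (hρ : ∀ z ∈ K₁ ×ˢ K₂, C₁ ≤ ρ z ∧ ρ z ≤ C₂) {Z : S → G₁ × G₂} (hZm : Measurable Z)
    (hZρ : P.map Z = (rect ν₁ ν₂ K₁ K₂).withDensity fun z => ENNReal.ofReal (ρ z))
    {H : G₁ × G₂ → ℂ} (hH : Measurable H) (hfin : oneNorm ν₁ ν₂ K₁ K₂ H ≠ ∞) :
    ∫ s, ‖H (Z s)‖ ∂P ∈ Set.Icc (C₁ * (oneNorm ν₁ ν₂ K₁ K₂ H).toReal)
      (C₂ * (oneNorm ν₁ ν₂ K₁ K₂ H).toReal) := by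
  have e1 : ∫ s, ‖H (Z s)‖ ∂P =
      (∫⁻ z, ENNReal.ofReal (ρ z) * ‖H z‖ₑ ∂(rect ν₁ ν₂ K₁ K₂)).toReal := by
    rw [integral_norm_eq_lintegral_enorm (f := fun s => H (Z s)) (hH.comp hZm).aestronglyMeasurable]
    congr 1
    rw [← lintegral_map (f := fun z => ‖H z‖ₑ) hH.enorm hZm, hZρ,
      lintegral_withDensity_eq_lintegral_mul _ hρm.ennreal_ofReal hH.enorm]
    rfl
  have hae := ae_rect_mem (ν₁ := ν₁) (ν₂ := ν₂) hK₁ hK₂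
  have hlow : ENNReal.ofReal C₁ * oneNorm ν₁ ν₂ K₁ K₂ H ≤
      ∫⁻ z, ENNReal.ofReal (ρ z) * ‖H z‖ₑ ∂(rect ν₁ ν₂ K₁ K₂) := by
    unfold oneNorm
    rw [← lintegral_const_mul _ hH.enorm]
    refine lintegral_mono_ae ?_
    filter_upwards [hae] with z hz
    gcongr
    exact (hρ z hz).1
  have hup : ∫⁻ z, ENNReal.ofReal (ρ z) * ‖H z‖ₑ ∂(rect ν₁ ν₂ K₁ K₂) ≤
      ENNReal.ofReal C₂ * oneNorm ν₁ ν₂ K₁ K₂ H := by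
    unfold oneNorm
    rw [← lintegral_const_mul _ hH.enorm]
    refine lintegral_mono_ae ?_
    filter_upwards [hae] with z hz
    gcongr
    exact (hρ z hz).2
  have htop : ENNReal.ofReal C₂ * oneNorm ν₁ ν₂ K₁ K₂ H ≠ ∞ :=
    ENNReal.mul_ne_top ENNReal.ofReal_ne_top hfin
  rw [e1]
  constructor
  · have := ENNReal.toReal_mono (ne_top_of_le_ne_top htop hup) hlow
    rwa [ENNReal.toReal_mul, ENNReal.toReal_ofReal hC₁] at this
  · have := ENNReal.toReal_mono htop hup
    rwa [ENNReal.toReal_mul, ENNReal.toReal_ofReal hC₂] at this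

/-- A random point with a density on a rectangle almost surely lies in it. -/
theorem ae_mem_of_map_eq (hK₁ : MeasurableSet K₁) (hK₂ : MeasurableSet K₂)
    {h : G₁ × G₂ → ℝ≥0∞} {Z : S → G₁ × G₂} (hZm : Measurable Z)
    (hZ : P.map Z = (rect ν₁ ν₂ K₁ K₂).withDensity h) : ∀ᵐ s ∂P, Z s ∈ K₁ ×ˢ K₂ := by
  have h1 : ∀ᵐ z ∂(P.map Z), z ∈ K₁ ×ˢ K₂ := by
    rw [hZ]
    exact (withDensity_absolutelyContinuous _ _).ae_le (ae_rect_mem hK₁ hK₂)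
  exact ae_of_ae_map hZm.aemeasurable h1

end Density

/-! ### Uniform deviation in homogeneous form. -/

section Seminorm

variable {S ι : Type*} [MeasurableSpace S] {P : Measure S} [IsProbabilityMeasure P]
  {E : Type*} [NormedAddCommGroup E] [NormedSpace ℝ E] [FiniteDimensional ℝ E]

/-- Uniform deviation bound for the norms of a linear process `Y`, bounded by `B ‖c‖`. -/
theorem exists_event_abs_sum_norm_sub_le (J : Finset ι) (Y : E → ι → S → ℂ)
    (hYm : ∀ c j, Measurable (Y c j))
    (hYsub : ∀ c c' j s, Y (c - c') j s = Y c j s - Y c' j s)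
    (hYsmul : ∀ (t : ℝ) c j s, Y (t • c) j s = t * Y c j s)
    (hYind : ∀ c c', iIndepFun (fun j s => ‖Y c j s‖ - ‖Y c' j s‖) P)
    {L B : ℝ} (hB : 0 ≤ B) (hYle : ∀ c j s, ‖Y c j s‖ ≤ L * B * ‖c‖)
    {d : ℕ} (hd : Module.finrank ℝ E = d) (hL : 0 < d → 0 < L) {η : ℝ} (hη : 0 < η)
    (hN : 108 * √2 * Real.log 2 * d / η * (2 + 162 / η) < J.card) :
    ∃ A : Set S, MeasurableSet A ∧
      1 - 2 * Real.exp (d * Real.log (8 * L)) *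
            Real.exp (-(J.card * (3 * η ^ 2 / (4 * L * (6 * L + η)))))
        - 4 / (3 * d * Real.log 2 ^ 2) * (4 * L) ^ (2 * d) *
            Real.exp (-(J.card * (η ^ 2 / (72 * √2 * (81 + η))))) ≤ P.real A ∧
      ∀ s ∈ A, ∀ c : E, |∑ j ∈ J, (‖Y c j s‖ - ∫ s', ‖Y c j s'‖ ∂P)| ≤
        J.card * η * (B * ‖c‖) := by
  have hY0 : ∀ j s, Y 0 j s = 0 := fun j s => by
    have := hYsub 0 0 j s
    rwa [sub_self, sub_self] at this
  -- For `d = 0` the parameter space is trivial and the whole space serves as event; the second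
  -- constant is a division by zero, that is `0`.
  rcases Nat.eq_zero_or_pos d with rfl | hd0
  · refine ⟨Set.univ, MeasurableSet.univ, ?_, fun s _ c => ?_⟩
    · have : 0 < Real.exp (-(J.card * (3 * η ^ 2 / (4 * L * (6 * L + η))))) := Real.exp_pos _
      simp only [probReal_univ, Nat.cast_zero]
      simp
      positivity
    · have : Subsingleton E := Module.finrank_zero_iff.1 hd
      rw [Subsingleton.elim c 0]
      simp [hY0]
  have hL := hL hd0
  -- For `B = 0` the quotients are `0` by convention, so the process is still Lipschitz.
  have hX : LipschitzProcess P L fun c j s => ‖Y c j s‖ / B :=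
    { measurable := fun c j => (hYm c j).norm.div_const B
      abs_sub_le := fun c c' j s => by
        rw [← sub_div, abs_div, abs_of_nonneg hB]
        refine div_le_of_le_mul₀ hB (by positivity) ?_
        calc |‖Y c j s‖ - ‖Y c' j s‖| ≤ ‖Y c j s - Y c' j s‖ := abs_norm_sub_norm_le _ _
          _ ≤ L * B * ‖c - c'‖ := by rw [← hYsub]; exact hYle _ _ _
          _ = _ := by ring
      nonneg := fun c j s => by positivity
      zero := fun j s => by simp [hY0]
      indep := fun c c' => by
        have := (hYind c c').comp (fun _ v => v / B) (fun _ => measurable_id.div_const B)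
        convert this using 2
        ext s
        simp [sub_div] }
  obtain ⟨A, hA, hPA, hdev⟩ := hX.exists_event_abs_centeredSum_le J d hd hd0 hL hη hN
  refine ⟨A, hA, hPA, fun s hs c => ?_⟩
  rcases eq_or_ne c 0 with rfl | hc
  · simp [hY0]
  rcases hB.eq_or_lt with hB0 | hB0
  · have : ∀ j s, Y c j s = 0 := fun j s => by
      have := hYle c j s
      rw [← hB0, mul_zero, zero_mul] at this
      exact norm_le_zero_iff.1 this
    simp [this, ← hB0]
  have hc0 : 0 < ‖c‖ := norm_pos_iff.2 hc
  have h1 := hdev s hs (‖c‖⁻¹ • c) (by rw [norm_smul, norm_inv, norm_norm, inv_mul_cancel₀ hc0.ne'])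
  have h2 : centeredSum P J (fun c j s => ‖Y c j s‖ / B) (‖c‖⁻¹ • c) s =
      (∑ j ∈ J, (‖Y c j s‖ - ∫ s', ‖Y c j s'‖ ∂P)) / (B * ‖c‖) := by
    unfold centeredSum
    rw [Finset.sum_div]
    refine Finset.sum_congr rfl fun j _ => ?_
    have h3 : ∀ s, ‖Y (‖c‖⁻¹ • c) j s‖ / B = ‖Y c j s‖ / (B * ‖c‖) := fun s => by
      rw [hYsmul, norm_mul, Complex.norm_real, norm_inv, norm_norm]
      field_simp
    simp_rw [h3, integral_div]
    rw [sub_div]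
  rw [h2, abs_div, abs_of_pos (mul_pos hB0 hc0), div_le_iff₀ (mul_pos hB0 hc0)] at h1
  exact h1

end Seminorm

end AvgSampling

/-! ### The sampling inequality. -/

theorem theorem3p3
    {G₁ G₂ : Type*}
    [AddCommGroup G₁] [TopologicalSpace G₁] [IsTopologicalAddGroup G₁] [LocallyCompactSpace G₁]
    [T2Space G₁] [MeasurableSpace G₁] [BorelSpace G₁]
    [AddCommGroup G₂] [TopologicalSpace G₂] [IsTopologicalAddGroup G₂] [LocallyCompactSpace G₂]
    [T2Space G₂] [MeasurableSpace G₂] [BorelSpace G₂]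
    -- Haar measures
    (ν₁ : Measure G₁) [ν₁.IsAddHaarMeasure] [ν₁.Regular]
    (ν₂ : Measure G₂) [ν₂.IsAddHaarMeasure] [ν₂.Regular]
    (p q : ℝ) (hp : 1 < p) (hq : 1 < q)
    -- separated nodes
    {I : Type*} [Countable I] (x : I → G₁) (y : I → G₂)
    (hx : AvgSampling.IsSeparated x) (hy : AvgSampling.IsSeparated y)
    -- the averaging function
    (W₁ : Set G₁) (W₂ : Set G₂) (hW₁ : IsCompact W₁) (hW₂ : IsCompact W₂)
    (h0W₁ : (0 : G₁) ∈ W₁) (h0W₂ : (0 : G₂) ∈ W₂)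
    (ω : G₁ × G₂ → ℂ) (hω : Integrable ω (AvgSampling.rect ν₁ ν₂ W₁ W₂))
    (hωW : Function.support ω ⊆ W₁ ×ˢ W₂)
    -- the sampling domain and the generators
    (K₁ : Set G₁) (K₂ : Set G₂) (hK₁ : IsCompact K₁) (hK₂ : IsCompact K₂)
    {r : ℕ} (φ : Fin r → G₁ × G₂ → ℂ) (hφc : ∀ i, Continuous (φ i))
    (hφs : ∀ i, HasCompactSupport (φ i)) (hφm : ∀ i, AvgSampling.MemMixed ν₁ ν₂ p q (φ i))
    (a₁ a₂ : ℝ) (ha₁ : 0 < a₁) (ha₂ : a₁ ≤ a₂)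
    (hΦ : AvgSampling.StableShifts ν₁ ν₂ p q x y φ (K₁ - W₁) (K₂ - W₂) a₁ a₂)
    (hΩ : IsSeqCompact (((K₁ - W₁) ×ˢ (K₂ - W₂)) - ⋃ i, tsupport (φ i)))
    -- the density
    (ρ : G₁ × G₂ → ℝ) (hρm : Measurable ρ) (C₁ C₂ : ℝ) (hC₁ : 0 < C₁)
    (hρ : ∀ z ∈ K₁ ×ˢ K₂, C₁ ≤ ρ z ∧ ρ z ≤ C₂)
    (hρ1 : ∫⁻ z, ENNReal.ofReal (ρ z) ∂(AvgSampling.rect ν₁ ν₂ K₁ K₂) = 1)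
    -- the i.i.d. sampling points, with density `ρ` on `K`
    {S : Type*} [MeasurableSpace S] (P : Measure S) [IsProbabilityMeasure P]
    (Z : ℕ → ℕ → S → G₁ × G₂) (hZm : ∀ j k, Measurable (Z j k))
    (hZi : iIndepFun (fun jk : ℕ × ℕ => Z jk.1 jk.2) P)
    (hZρ : ∀ j k, P.map (Z j k) =
      (AvgSampling.rect ν₁ ν₂ K₁ K₂).withDensity (fun z => ENNReal.ofReal (ρ z)))
    -- the parameters
    (μ η : ℝ) (hμ0 : 0 < μ) (hμ1 : μ ≤ 1) (hη0 : 0 < η) (hη : η < μ * C₁)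
    (d : ℕ) (hd : d = AvgSampling.dimVK ν₁ ν₂ p q x y φ (K₁ - W₁) (K₂ - W₂))
    (C : ℝ) (hC : C = AvgSampling.CPhi x y φ (K₁ - W₁) (K₂ - W₂))
    (n m : ℕ)
    (hnm : 108 * √2 * Real.log 2 * d / η * (2 + 162 / η) < (n : ℝ) * m) :
    ∃ E : Set S, MeasurableSet E ∧
      1 - AvgSampling.constA₁ d C a₁ *
            Real.exp (-(n * m * (3 * a₁ ^ 2 * η ^ 2 / (4 * C * (6 * C + η * a₁)))))
        - AvgSampling.constA₂ d C a₁ *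
            Real.exp (-(n * m * (η ^ 2 / (72 * √2 * (81 + η))))) ≤ P.real E ∧
      ∀ s ∈ E, ∀ f ∈ AvgSampling.VKω ν₁ ν₂ p q x y φ K₁ W₁ K₂ W₂ ω μ,
        n * m * (AvgSampling.oneNorm ν₁ ν₂ W₁ W₂ ω).toReal * (μ * C₁ - η) *
            (AvgSampling.mixedNorm ν₁ ν₂ p q (K₁ - W₁) (K₂ - W₂) f).toReal
          ≤ ∑ j ∈ Finset.range n, ∑ k ∈ Finset.range m, ‖AvgSampling.conv ν₁ ν₂ f ω (Z j k s)‖ ∧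
        ∑ j ∈ Finset.range n, ∑ k ∈ Finset.range m, ‖AvgSampling.conv ν₁ ν₂ f ω (Z j k s)‖
          ≤ n * m * (AvgSampling.oneNorm ν₁ ν₂ W₁ W₂ ω).toReal *
            (C₂ * ν₁.real K₁ ^ ((p - 1) / p) * ν₂.real K₂ ^ ((q - 1) / q) + η) *
            (AvgSampling.mixedNorm ν₁ ν₂ p q (K₁ - W₁) (K₂ - W₂) f).toReal := by
  classical
  have hp0 : 0 < p := by linarith
  have hq0 : 0 < q := by linarith
  have fin₁ : ∀ {A : Set G₁}, IsCompact A → IsFiniteMeasure (ν₁.restrict A) := fun hA =>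
    ⟨by rw [Measure.restrict_apply_univ]; exact hA.measure_lt_top⟩
  have fin₂ : ∀ {A : Set G₂}, IsCompact A → IsFiniteMeasure (ν₂.restrict A) := fun hA =>
    ⟨by rw [Measure.restrict_apply_univ]; exact hA.measure_lt_top⟩
  have hA : IsCompact (K₁ - W₁) := by rw [sub_eq_add_neg]; exact hK₁.add hW₁.neg
  have hB : IsCompact (K₂ - W₂) := by rw [sub_eq_add_neg]; exact hK₂.add hW₂.neg
  have := fin₁ hK₁
  have := fin₂ hK₂
  have := fin₁ hW₁
  have := fin₂ hW₂
  have := fin₂ hB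
  set T := AvgSampling.activeShifts x y φ (K₁ - W₁) (K₂ - W₂) with hT
  have : Fintype T := (AvgSampling.finite_activeShifts hx hy hφs hA hB).fintype
  let F : (Fin r → T → ℂ) → G₁ × G₂ → ℂ := AvgSampling.shiftSum x y φ T
  have hFc : ∀ c, Continuous (F c) := AvgSampling.continuous_shiftSum hφc
  have hFm : ∀ c, Measurable (F c) := AvgSampling.measurable_shiftSum fun i => (hφm i).1
  have hFmem : ∀ c, AvgSampling.MemMixed ν₁ ν₂ p q (F c) := fun c =>
    AvgSampling.memMixed_of_hasCompactSupport hp0 hq0 (hFm c) (hFc c)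
      (AvgSampling.hasCompactSupport_shiftSum hφs c)
  have hFfin : ∀ c, AvgSampling.mixedNorm ν₁ ν₂ p q (K₁ - W₁) (K₂ - W₂) (F c) ≠ ∞ := fun c =>
    ((AvgSampling.mixedNorm_mono_set hp0 hq0 (Set.subset_univ _) (Set.subset_univ _) _).trans_lt
      (hFmem c).2).ne
  have hC0 : 0 ≤ C := hC ▸ AvgSampling.CPhi_nonneg
  have hFle : ∀ c, ∀ z ∈ (K₁ - W₁) ×ˢ (K₂ - W₂), ‖F c z‖ ≤ C * ‖c‖ := fun c z hz =>
    hC ▸ AvgSampling.norm_shiftSum_le hφc hA hB c hz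
  have hstab : ∀ c, a₁ * ‖c‖ ≤
      (AvgSampling.mixedNorm ν₁ ν₂ p q (K₁ - W₁) (K₂ - W₂) (F c)).toReal := fun c =>
    hΦ.mul_norm_le ha₁ hp0 hq0 c (hFfin c)
  have hdim : Module.finrank ℝ (Fin r → T → ℂ) = d := by
    rw [hd]
    exact AvgSampling.finrank_eq_dimVK hA.measurableSet hB.measurableSet hp0 hq0 hFmem ha₁ hΦ
  -- If `C = 0`, every `F c` vanishes on `K̃`, and stability leaves only `c = 0`.
  have hCpos : 0 < d → 0 < C := by
    intro hd0
    rw [← hdim] at hd0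
    have := Module.nontrivial_of_finrank_pos hd0
    obtain ⟨c, hc⟩ := exists_ne (0 : Fin r → T → ℂ)
    refine lt_of_le_of_ne hC0 fun hC' => ?_
    have h1 : F c =ᵐ[AvgSampling.rect ν₁ ν₂ (K₁ - W₁) (K₂ - W₂)] fun _ => (0 : ℂ) := by
      filter_upwards [AvgSampling.ae_rect_mem (ν₁ := ν₁) (ν₂ := ν₂) hA.measurableSet
        hB.measurableSet] with z hz
      have := hFle c z hz
      rw [← hC', zero_mul] at this
      exact norm_le_zero_iff.1 this
    have h2 := hstab c
    rw [AvgSampling.mixedNorm_congr_ae p q h1] at h2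
    simp only [AvgSampling.mixedNorm, enorm_zero, ENNReal.zero_rpow_of_pos hq0, lintegral_zero,
      ENNReal.zero_rpow_of_pos (div_pos hp0 hq0),
      ENNReal.zero_rpow_of_pos (one_div_pos.2 hp0), ENNReal.toReal_zero] at h2
    exact hc (norm_le_zero_iff.1 (nonpos_of_mul_nonpos_right h2 ha₁))
  -- Integrability makes `ω` only almost everywhere measurable; a measurable version is needed for
  -- the average to be measurable in `z`.
  obtain ⟨ω', hω'm, hωω'⟩ := hω.1
  have hω'i : Integrable ω' (AvgSampling.rect ν₁ ν₂ W₁ W₂) := hω.congr hωω'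
  have hone : AvgSampling.oneNorm ν₁ ν₂ W₁ W₂ ω' = AvgSampling.oneNorm ν₁ ν₂ W₁ W₂ ω := by
    refine lintegral_congr_ae ?_
    filter_upwards [hωω'] with w hw
    rw [hw]
  set w := (AvgSampling.oneNorm ν₁ ν₂ W₁ W₂ ω).toReal with hw
  have hw0 : 0 ≤ w := ENNReal.toReal_nonneg
  have honefin : AvgSampling.oneNorm ν₁ ν₂ W₁ W₂ ω ≠ ∞ := hω.2.ne
  let V : (Fin r → T → ℂ) → G₁ × G₂ → ℂ := fun c =>
    AvgSampling.average ν₁ ν₂ K₁ W₁ K₂ W₂ ω' (F c)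
  have hVm : ∀ c, Measurable (V c) := fun c =>
    AvgSampling.measurable_average hK₁ hK₂ hW₁ hW₂ hω'm.measurable (hFc c)
  have hVle : ∀ c z, ‖V c z‖ ≤ C * ‖c‖ * w := fun c z => by
    have := AvgSampling.norm_average_le hω'i (mul_nonneg hC0 (norm_nonneg c)) (hFle c) z
    rwa [hone] at this
  have hVsub : ∀ c c' z, V (c - c') z = V c z - V c' z := fun c c' z => by
    have := AvgSampling.average_sub hK₁ hK₂ hW₁ hW₂ hω'i (hFc c) (hFc c')
      (mul_nonneg hC0 (norm_nonneg c)) (mul_nonneg hC0 (norm_nonneg c')) (hFle c) (hFle c') z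
    rw [← this]
    exact congrArg (fun f => AvgSampling.average ν₁ ν₂ K₁ W₁ K₂ W₂ ω' f z)
      (AvgSampling.shiftSum_sub c c')
  have hVsmul : ∀ (t : ℝ) c z, V (t • c) z = t * V c z := fun t c z => by
    rw [← AvgSampling.average_smul]
    exact congrArg (fun f => AvgSampling.average ν₁ ν₂ K₁ W₁ K₂ W₂ ω' f z)
      (AvgSampling.shiftSum_smul t c)
  have hcard : ((Finset.range n ×ˢ Finset.range m).card : ℝ) = n * m := by simp
  obtain ⟨A, hAm, hPA, hdev⟩ := AvgSampling.exists_event_abs_sum_norm_sub_le (P := P)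
    (Finset.range n ×ˢ Finset.range m) (fun c jk s => V c (Z jk.1 jk.2 s))
    (fun c jk => (hVm c).comp (hZm _ _)) (fun c c' jk s => hVsub c c' _)
    (fun t c jk s => hVsmul t c _)
    (fun c c' => hZi.comp (fun _ z => ‖V c z‖ - ‖V c' z‖)
      (fun _ => (hVm c).norm.sub (hVm c').norm))
    -- With `L * B = C * w` this is the bound `hVle`; the factor `a₁` in `B` turns `B * ‖c‖` into at
    -- most `w` times the mixed norm.
    (L := C / a₁) (B := a₁ * w) (mul_nonneg ha₁.le hw0)
    (fun c jk s => (hVle c _).trans_eq (by field_simp)) hdim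
    (fun hd0 => div_pos (hCpos hd0) ha₁) hη0 (by rwa [hcard])
  rw [hcard] at hPA hdev
  have hZK : ∀ᵐ s ∂P, ∀ j k, Z j k s ∈ K₁ ×ˢ K₂ := by
    rw [ae_all_iff]; intro j
    rw [ae_all_iff]; intro k
    exact AvgSampling.ae_mem_of_map_eq hK₁.measurableSet hK₂.measurableSet (hZm j k) (hZρ j k)
  have hZKm : MeasurableSet {s | ∀ j k, Z j k s ∈ K₁ ×ˢ K₂} := by
    simp only [Set.ofPred_forall]
    exact MeasurableSet.iInter fun j => MeasurableSet.iInter fun k =>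
      hZm j k (hK₁.measurableSet.prod hK₂.measurableSet)
  -- The convolution is identified with `V c` only on `K`, which contains all sample points almost
  -- surely.
  refine ⟨A ∩ {s | ∀ j k, Z j k s ∈ K₁ ×ˢ K₂}, hAm.inter hZKm, ?_, ?_⟩
  · have h1 : P.real (A ∩ {s | ∀ j k, Z j k s ∈ K₁ ×ˢ K₂}) = P.real A := by
      refine measureReal_congr ?_
      filter_upwards [hZK] with s hs
      exact propext (and_iff_left hs)
    rw [h1]
    refine le_trans (le_of_eq ?_) hPA
    have e1 : 3 * a₁ ^ 2 * η ^ 2 / (4 * C * (6 * C + η * a₁)) =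
        3 * η ^ 2 / (4 * (C / a₁) * (6 * (C / a₁) + η)) := by
      rcases hC0.eq_or_lt with h | h
      · simp [← h]
      · field_simp
    rw [AvgSampling.constA₁, AvgSampling.constA₂, e1, mul_div_assoc 8, mul_div_assoc 4 C]
  rintro s ⟨hsA, hsK⟩ f ⟨hfV, hfμ⟩
  obtain ⟨c, hc⟩ := AvgSampling.exists_shiftSum_of_mem_VK hA.measurableSet hB.measurableSet hfV
  change f =ᵐ[_] F c at hc
  have hconv : ∀ z ∈ K₁ ×ˢ K₂, AvgSampling.conv ν₁ ν₂ f ω z = V c z := fun z hz =>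
    AvgSampling.conv_eq_average hK₁ hK₂ hW₁ hW₂ hω hωW hωω' (hFc c)
      (mul_nonneg hC0 (norm_nonneg c)) (hFle c) hc hz
  have hNf := AvgSampling.mixedNorm_congr_ae (ν₁ := ν₁) (ν₂ := ν₂) p q hc
  have hK1 : AvgSampling.oneNorm ν₁ ν₂ K₁ K₂ (AvgSampling.conv ν₁ ν₂ f ω) =
      AvgSampling.oneNorm ν₁ ν₂ K₁ K₂ (V c) := by
    refine lintegral_congr_ae ?_
    filter_upwards [AvgSampling.ae_rect_mem (ν₁ := ν₁) (ν₂ := ν₂) hK₁.measurableSet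
      hK₂.measurableSet] with z hz
    rw [hconv z hz]
  rw [hK1, hNf] at hfμ
  rw [hNf]
  have hup := AvgSampling.oneNorm_average_le (ν₁ := ν₁) (ν₂ := ν₂) hK₁ hK₂ hW₁ hW₂ hp hq
    hω'm.measurable (hFc c) (hFm c)
  rw [hone] at hup
  change AvgSampling.oneNorm ν₁ ν₂ K₁ K₂ (V c) ≤ _ at hup
  have hm₁ : ν₁ K₁ ^ ((p - 1) / p) ≠ ∞ := (ENNReal.rpow_lt_top_of_nonneg
    (div_nonneg (by linarith) hp0.le) hK₁.measure_lt_top.ne).ne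
  have hm₂ : ν₂ K₂ ^ ((q - 1) / q) ≠ ∞ := (ENNReal.rpow_lt_top_of_nonneg
    (div_nonneg (by linarith) hq0.le) hK₂.measure_lt_top.ne).ne
  have htop := ENNReal.mul_ne_top honefin
    (ENNReal.mul_ne_top (hFfin c) (ENNReal.mul_ne_top hm₁ hm₂))
  have hVfin : AvgSampling.oneNorm ν₁ ν₂ K₁ K₂ (V c) ≠ ∞ := ne_top_of_le_ne_top htop hup
  have hup' := ENNReal.toReal_mono htop hup
  have hlow' := ENNReal.toReal_mono hVfin hfμ
  simp only [ENNReal.toReal_mul, ← ENNReal.toReal_rpow, ENNReal.toReal_ofReal hμ0.le] at hup' hlow'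
  rw [← hw] at hup' hlow'
  change _ ≤ w * (_ * (ν₁.real K₁ ^ _ * ν₂.real K₂ ^ _)) at hup'
  -- A negative upper bound would contradict total mass one.
  have hC₂ : 0 ≤ C₂ := by
    by_contra! hneg
    have : ∫⁻ z, ENNReal.ofReal (ρ z) ∂(AvgSampling.rect ν₁ ν₂ K₁ K₂) = 0 := by
      rw [lintegral_eq_zero_iff hρm.ennreal_ofReal]
      filter_upwards [AvgSampling.ae_rect_mem (ν₁ := ν₁) (ν₂ := ν₂) hK₁.measurableSet
        hK₂.measurableSet] with z hz
      exact ENNReal.ofReal_eq_zero.2 ((hρ z hz).2.trans hneg.le)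
    rw [hρ1] at this
    exact one_ne_zero this
  set Nf := (AvgSampling.mixedNorm ν₁ ν₂ p q (K₁ - W₁) (K₂ - W₂) (F c)).toReal with hNfdef
  set V1 := (AvgSampling.oneNorm ν₁ ν₂ K₁ K₂ (V c)).toReal with hV1
  have hmean : ∀ jk : ℕ × ℕ, ∫ s', ‖V c (Z jk.1 jk.2 s')‖ ∂P ∈ Set.Icc (C₁ * V1) (C₂ * V1) :=
    fun jk => AvgSampling.integral_norm_comp_mem_Icc hK₁.measurableSet hK₂.measurableSet hρm hC₁.le
      hC₂ hρ (hZm _ _) (hZρ _ _) (hVm c) hVfin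
  have hsum : ∑ j ∈ Finset.range n, ∑ k ∈ Finset.range m, ‖AvgSampling.conv ν₁ ν₂ f ω (Z j k s)‖ =
      ∑ jk ∈ Finset.range n ×ˢ Finset.range m, ‖V c (Z jk.1 jk.2 s)‖ := by
    rw [Finset.sum_product]
    exact Finset.sum_congr rfl fun j _ => Finset.sum_congr rfl fun k _ => by
      rw [hconv _ (hsK j k)]
  have hd1 := hdev s hsA c
  rw [Finset.sum_sub_distrib, abs_le] at hd1
  have hd2 : (n : ℝ) * m * η * (a₁ * w * ‖c‖) ≤ n * m * η * (w * Nf) := by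
    refine mul_le_mul_of_nonneg_left ?_ (by positivity)
    linarith [mul_le_mul_of_nonneg_left (hstab c) hw0]
  have hm1 : (n : ℝ) * m * (C₁ * V1) ≤
      ∑ jk ∈ Finset.range n ×ˢ Finset.range m, ∫ s', ‖V c (Z jk.1 jk.2 s')‖ ∂P := by
    rw [← hcard, ← nsmul_eq_mul]
    exact Finset.card_nsmul_le_sum _ _ _ fun jk _ => (hmean jk).1
  have hm2 : ∑ jk ∈ Finset.range n ×ˢ Finset.range m, ∫ s', ‖V c (Z jk.1 jk.2 s')‖ ∂P ≤
      (n : ℝ) * m * (C₂ * V1) := by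
    rw [← hcard, ← nsmul_eq_mul]
    exact Finset.sum_le_card_nsmul _ _ _ fun jk _ => (hmean jk).2
  have hm3 : (n : ℝ) * m * (C₁ * (μ * w * Nf)) ≤ n * m * (C₁ * V1) := by gcongr
  have hm4 : (n : ℝ) * m * (C₂ * V1) ≤ n * m * (C₂ * (w * (Nf * (ν₁.real K₁ ^ ((p - 1) / p) *
      ν₂.real K₂ ^ ((q - 1) / q))))) := by gcongr
  rw [hsum]
  constructor
  · linarith [hd1.1]
  · linarith [hd1.2]
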